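/- \textbf{Setting.} Fix a vocabulary with countably infinitely many constants and, for every arity, countably infinitely many predicates. An atom is $p(t_1,\dots,t_k)$ with each $t_i$ a variable or a constant. A fact is an atom without variables; a fact base is a finite set of facts. A Boolean conjunctive query (CQ) is an existentially closed finite conjunction of atoms, identified with its set of atoms; it is atomic if it is a single atom. An (existential) rule is a sentence $\forall \vec x\,\forall\vec y\,(B[\vec x,\vec y]\to\exists\vec z\,H[\vec x,\vec z])$ with $B$ (body) and $H$ (head) finite conjunctions of atoms; the variables $\vec z$, which occur only in $H$, are its existential variables. A knowledge base (KB) $(\mathcal F,\mathcal R)$ consists of a fact base and a finite set of rules, and $\models$ is first-order entailment. \textbf{fes.} A model $M$ of $(\mathcal F,\mathcal R)$ is universal if for every CQ $Q$: $M\models Q$ iff $\mathcal F,\mathcal R\models Q$. A finite rule set $\mathcal R$ is a finite expansion set (fes) if for every fact base $\mathcal F$ the KB $(\mathcal F,\mathcal R)$ has a finite universal model. \textbf{fus.} Let $Q$ be a CQ and $R=B\to H$ a rule with variables renamed so that they do not occur in $Q$. A piece-unifier of $Q$ with $R$ is a triple $(Q',H',P)$ with $\emptyset\ne Q'\subseteq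 Q$, $H'\subseteq H$ and $P$ a partition of the terms of $Q'\cup H'$ in which no class contains two constants, such that (1) $\sigma(H')=\sigma(Q')$, where $\sigma$ is any substitution that maps all terms of each class to one selected element of the class, a constant if the class contains one; (2) if a class contains an existential variable of $R$, its other terms are variables of $Q'$ that do not occur in $Q\setminus Q'$. It is single-piece if there is no nonempty proper subset $Q''$ of $Q'$ such that no term of $Q''$ lying in the class of an existential variable occurs in $Q\setminus Q''$. A direct rewriting of $Q$ with $R$ is a CQ $\sigma(Q\setminus Q')\cup\sigma(B)$ obtained from a single-piece unifier and a substitution $\sigma$ as above. A rewriting of $Q$ w.r.t. $\mathcal R$ is a CQ obtained from $Q$ by a finite, possibly empty, sequence of direct rewritings with rules of $\mathcal R$. A finite rule set $\mathcal R$ is a finite unification set (fus) if for every CQ $Q$ there is a finite set $S$ of rewritings of $Q$ w.r.t. $\mathcal R$ such that for every fact base $\mathcal F$: $\mathcal F,\mathcal R\models Q$ iff $\mathcal F\models Q'$ for some $Q'\in S$. \textbf{Adding transitivity.} A transitivity rule is a rule $p(x,y)\wedge p(y,z)\to p(x,z)$ with $p$ a binary predicate and $x,y,z$ distinct variables. For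 a class $\mathcal C$ of finite rule sets, $\mathcal C$+trans is the class of the rule sets $\mathcal R\cup\mathcal T$ with $\mathcal R\in\mathcal C$ and $\mathcal T$ a finite set of transitivity rules. \textbf{Statement.} Atomic CQ entailment over fus+trans KBs is undecidable, and atomic CQ entailment over fes+trans KBs is undecidable. That is, for $\mathcal C=$ fus and for $\mathcal C=$ fes, there is no algorithm that, for every KB $(\mathcal F,\mathcal R)$ with $\mathcal R\in\mathcal C$+trans and every atomic CQ $Q$ given as input, halts and correctly answers whether $\mathcal F,\mathcal R\models Q$ (its behaviour on other inputs being arbitrary). -/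

import Mathlib

namespace ExRule

/-! ### Syntax

The vocabulary has countably many constants and, for every arity, countably many predicates. -/

/-- A term: `Sum.inl x` is the variable `x`, `Sum.inr c` is the constant `c`. -/
abbrev Term := ℕ ⊕ ℕ

/-- The variable `x` as a term. -/
abbrev var (x : ℕ) : Term := Sum.inl x

/-- The constant `c` as a term. -/
abbrev cst (c : ℕ) : Term := Sum.inr c

/-- An atom `p(t₁, …, tₖ)` is a predicate name together with its list of arguments. The predicate is
determined by its name and its arity `k`: one name used with two arities gives two predicates. -/
abbrev Atom := ℕ × List Term

/-- A fact, i.e. an atom without variables; the arguments are constants. -/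
abbrev Fact := ℕ × List ℕ

/-- A Boolean conjunctive query: the set of atoms of an existentially closed conjunction. -/
abbrev CQ := Finset Atom

/-- An existential rule `B → H`, given by the list of atoms of its body and that of its head. -/
abbrev Rule := List Atom × List Atom

/-- A knowledge base: a finite list of facts and a finite list of rules. -/
abbrev KB := List Fact × List Rule

/-- The fact base of a knowledge base. -/
def KB.factBase (K : KB) : Finset Fact := K.1.toFinset

/-- The rule set of a knowledge base. -/
def KB.ruleSet (K : KB) : Finset Rule := K.2.toFinset

/-- The body of a rule, as a set of atoms. -/
def Rule.body (R : Rule) : Finset Atom := R.1.toFinset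

/-- The head of a rule, as a set of atoms. -/
def Rule.head (R : Rule) : Finset Atom := R.2.toFinset

/-- The terms that occur in a set of atoms. -/
def terms (A : Finset Atom) : Set Term := {t | ∃ a ∈ A, t ∈ a.2}

/-- The variables that occur in a set of atoms. -/
def vars (A : Finset Atom) : Set ℕ := {x | var x ∈ terms A}

/-- The variables of a rule. -/
def Rule.vars (R : Rule) : Set ℕ := ExRule.vars R.body ∪ ExRule.vars R.head

/-- The existential variables of a rule: those that occur only in its head. -/
def Rule.existVars (R : Rule) : Set ℕ := ExRule.vars R.head \ ExRule.vars R.body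

/-! ### First-order semantics -/

/-- A first-order interpretation with domain `D`. The relation that interprets the `k`-ary predicate
with name `p` is the restriction of `rel p` to lists of length `k`. -/
structure Interp (D : Type) where
  /-- The interpretation of the constants. -/
  const : ℕ → D
  /-- The interpretation of the predicates. -/
  rel : ℕ → List D → Prop

namespace Interp

variable {D : Type}

/-- The value of a term under the variable assignment `v`. -/
def val (M : Interp D) (v : ℕ → D) : Term → D := Sum.elim v M.const

/-- An atom holds under the variable assignment `v`. -/
def Holds (M : Interp D) (v : ℕ → D) (a : Atom) : Prop := M.rel a.1 (a.2.map (M.val v))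

/-- `M` satisfies a fact. -/
def SatFact (M : Interp D) (f : Fact) : Prop := M.rel f.1 (f.2.map M.const)

/-- `M` satisfies the existential closure of the conjunction of the atoms of `Q`. -/
def SatCQ (M : Interp D) (Q : CQ) : Prop := ∃ v : ℕ → D, ∀ a ∈ Q, M.Holds v a

/-- `M` satisfies the sentence `∀ x y, (B[x, y] → ∃ z, H[x, z])`: every assignment that makes the
body true can be changed outside the variables of the body so that the head becomes true. -/
def SatRule (M : Interp D) (R : Rule) : Prop :=
  ∀ v : ℕ → D, (∀ a ∈ R.body, M.Holds v a) →
    ∃ w : ℕ → D, (∀ x ∈ vars R.body, w x = v x) ∧ ∀ a ∈ R.head, M.Holds w a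

/-- `M` is a model of the knowledge base `(F, 𝓡)`. -/
def IsModel (M : Interp D) (F : Finset Fact) (𝓡 : Finset Rule) : Prop :=
  (∀ f ∈ F, M.SatFact f) ∧ ∀ R ∈ 𝓡, M.SatRule R

end Interp

/-- Logical entailment `F, 𝓡 ⊨ Q`. (A domain is nonempty, since an interpretation gives values to
the constants.) -/
def Entails (F : Finset Fact) (𝓡 : Finset Rule) (Q : CQ) : Prop :=
  ∀ (D : Type) (M : Interp D), M.IsModel F 𝓡 → M.SatCQ Q

/-- `M` is a universal model of `(F, 𝓡)`. -/
def Interp.IsUniversal {D : Type} (M : Interp D) (F : Finset Fact) (𝓡 : Finset Rule) : Prop :=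
  M.IsModel F 𝓡 ∧ ∀ Q : CQ, M.SatCQ Q ↔ Entails F 𝓡 Q

/-! ### Piece-unifiers and rewritings -/

/-- Apply a map on terms to an atom. -/
def substAtom (σ : Term → Term) (a : Atom) : Atom := (a.1, a.2.map σ)

/-- Apply a map on terms to a set of atoms. -/
def subst (σ : Term → Term) (A : Finset Atom) : Finset Atom := A.image (substAtom σ)

/-- Rename the variables of a rule by `ρ`. -/
def Rule.rename (ρ : ℕ → ℕ) (R : Rule) : Rule :=
  (R.1.map (substAtom (Sum.map ρ id)), R.2.map (substAtom (Sum.map ρ id)))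

/-- `P` represents a partition of the set of terms `T`: a term outside `T` is related to itself only,
and the classes of the partition are the classes of the elements of `T`. -/
def IsPartitionOf (P : Setoid Term) (T : Set Term) : Prop :=
  ∀ t u, P t u → t = u ∨ (t ∈ T ∧ u ∈ T)

/-- No class contains two constants. -/
def Admissible (P : Setoid Term) : Prop := ∀ c d, P (cst c) (cst d) → c = d

/-- `σ` is obtained from `P` by selecting an element in each class, with priority given to constants:
it is constant on each class, its value belongs to the class, and a class that contains a
constant is sent to that constant. -/
def ObtainedFrom (σ : Term → Term) (P : Setoid Term) : Prop :=
  (∀ t u, P t u → σ t = σ u) ∧ (∀ t, P t (σ t)) ∧ ∀ c, σ (cst c) = cst c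

/-- `(Q', H', P)` is a piece-unifier of the query `Q` with the rule `R` (whose variables are assumed
not to occur in `Q`). The last clause is the condition on the classes that contain an
existential variable of `R`. -/
structure IsPieceUnifier (Q : CQ) (R : Rule) (Q' H' : Finset Atom) (P : Setoid Term) : Prop where
  subset_query : Q' ⊆ Q
  nonempty : Q'.Nonempty
  subset_head : H' ⊆ R.head
  partition : IsPartitionOf P (terms (Q' ∪ H'))
  admissible : Admissible P
  unify : ∀ σ, ObtainedFrom σ P → subst σ H' = subst σ Q'
  exist : ∀ z ∈ R.existVars, var z ∈ terms (Q' ∪ H') → ∀ t, P (var z) t → t ≠ var z →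
    ∃ x : ℕ, t = var x ∧ x ∈ vars Q' ∧ x ∉ vars (Q \ Q')

/-- `Q'` is a piece: no nonempty proper subset `Q''` of `Q'` satisfies the condition on existential
variables for the restricted partition, that is, is such that the terms of `Q''` in the
class of an existential variable do not occur in `Q \ Q''`. -/
def IsPiece (Q : CQ) (R : Rule) (Q' : Finset Atom) (P : Setoid Term) : Prop :=
  ¬ ∃ Q'' : Finset Atom, Q'' ⊂ Q' ∧ Q''.Nonempty ∧
    ∀ z ∈ R.existVars, ∀ t ∈ terms Q'', P (var z) t → t ≠ var z → t ∉ terms (Q \ Q'')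

/-- `Q₁` is a direct rewriting of `Q` with the rule `R`: for some variant `R.rename ρ` of `R` whose
variables do not occur in `Q`, and some single-piece unifier `(Q', H', P)` of `Q` with it,
`Q₁ = σ(Q \ Q') ∪ σ(B)`. -/
def DirectRewriting (R : Rule) (Q Q₁ : CQ) : Prop :=
  ∃ ρ : ℕ → ℕ, Function.Injective ρ ∧ Disjoint (R.rename ρ).vars (vars Q) ∧
    ∃ (Q' H' : Finset Atom) (P : Setoid Term) (σ : Term → Term),
      IsPieceUnifier Q (R.rename ρ) Q' H' P ∧ IsPiece Q (R.rename ρ) Q' P ∧ ObtainedFrom σ P ∧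
      Q₁ = subst σ (Q \ Q') ∪ subst σ (R.rename ρ).body

/-- `Q'` is a rewriting of `Q` with respect to `𝓡`: it is reached from `Q` by finitely many (possibly
zero) direct rewritings with rules of `𝓡`. -/
def IsRewriting (𝓡 : Finset Rule) (Q Q' : CQ) : Prop :=
  Relation.ReflTransGen (fun Q₁ Q₂ => ∃ R ∈ 𝓡, DirectRewriting R Q₁ Q₂) Q Q'

/-! ### Classes of rule sets -/

/-- Finite expansion sets: every knowledge base `(F, 𝓡)` has a finite universal model. -/
def fes : Set (Finset Rule) :=
  {𝓡 | ∀ F : Finset Fact, ∃ (D : Type) (_ : Finite D) (M : Interp D), M.IsUniversal F 𝓡}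

/-- Finite unification sets: every query `Q` has a finite set of rewritings that is complete for every
fact base. -/
def fus : Set (Finset Rule) :=
  {𝓡 | ∀ Q : CQ, ∃ S : Finset CQ, (∀ Q' ∈ S, IsRewriting 𝓡 Q Q') ∧
    ∀ F : Finset Fact, Entails F 𝓡 Q ↔ ∃ Q' ∈ S, Entails F ∅ Q'}

/-- Transitivity rules `p(x, y) ∧ p(y, z) → p(x, z)`. -/
def IsTransitivityRule (R : Rule) : Prop :=
  ∃ p x y z : ℕ, x ≠ y ∧ y ≠ z ∧ x ≠ z ∧
    R.body = {(p, [var x, var y]), (p, [var y, var z])} ∧ R.head = {(p, [var x, var z])}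

/-- `𝓒 + trans`: the rule sets obtained from a rule set of `𝓒` by adding transitivity rules. -/
def plusTrans (𝓒 : Set (Finset Rule)) : Set (Finset Rule) :=
  {𝓢 | ∃ 𝓡 ∈ 𝓒, ∃ 𝓣 : Finset Rule, (∀ R ∈ 𝓣, IsTransitivityRule R) ∧ 𝓢 = 𝓡 ∪ 𝓣}

/-! ### The decision problem -/

/-- Atomic CQ entailment over knowledge bases with rule set in `𝓒` is decidable: some algorithm, given
a knowledge base `K` with rule set in `𝓒` and an atom `q`, halts and answers whether `K ⊨ q`.
Nothing is required of the algorithm on the other inputs. -/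
def AtomicEntailmentDecidable (𝓒 : Set (Finset Rule)) : Prop :=
  ∃ f : KB × Atom →. Bool, Partrec f ∧
    ∀ (K : KB) (q : Atom), KB.ruleSet K ∈ 𝓒 →
      ∃ b ∈ f (K, q), (b = true ↔ Entails (KB.factBase K) (KB.ruleSet K) {q})

end ExRule

/-!
Clauses `B → ∃ z, H` with a single head atom can be evaluated by existential rules that are
harmless as long as no transitivity is available. Represent an atom `α = j(x₁, …, xₖ)` by an object
`s` with an edge `eⱼᵢ` from every argument `xᵢ` to `s`. The rule of a clause creates an object for
its head atom, but links the arguments to it only by paths of two edges through a fresh null. Thus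
no body can be mapped to what the rules create: the chase stops after one step, so that the rules
have finite universal models, and every piece rewriting step trades atoms that are not mapped to
facts for atoms that are, so that finitely many rewritings suffice. Transitivity of the predicates
`eⱼᵢ` turns these paths into edges. The rules then simulate the clauses, which can evaluate the
programs of a universal model of computation, and halting reduces to the entailment of an atom.
-/

namespace ExRule

theorem finite_terms (A : Finset Atom) : (terms A).Finite := by
  have hterms : terms A = ⋃ a ∈ A, {t | t ∈ a.2} := by
    ext t
    simp [terms]
  rw [hterms]
  exact A.finite_toSet.biUnion fun a _ => List.finite_toSet a.2

theorem finite_vars (A : Finset Atom) : (vars A).Finite :=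
  (finite_terms A).preimage Sum.inl_injective.injOn

instance (A : Finset Atom) : Finite (vars A) := finite_vars A

instance (R : Rule) : Finite R.existVars := (finite_vars R.head).sdiff.to_subtype

/-- The constants that occur in a knowledge base. -/
def constants (F : Finset Fact) (𝓡 : Finset Rule) : Set ℕ :=
  {c | (∃ f ∈ F, c ∈ f.2) ∨ ∃ R ∈ 𝓡, cst c ∈ terms R.body ∪ terms R.head}

theorem finite_constants (F : Finset Fact) (𝓡 : Finset Rule) : (constants F 𝓡).Finite := by
  have hconstants : constants F 𝓡 = (⋃ f ∈ F, {c | c ∈ f.2}) ∪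
      ⋃ R ∈ 𝓡, Sum.inr ⁻¹' (terms R.body ∪ terms R.head) := by
    ext c
    simp [constants]
  rw [hconstants]
  exact (F.finite_toSet.biUnion fun f _ => List.finite_toSet f.2).union
    (𝓡.finite_toSet.biUnion fun R _ =>
      ((finite_terms R.body).union (finite_terms R.head)).preimage Sum.inr_injective.injOn)

theorem Interp.Holds.of_hom {D E : Type} {M : Interp D} {N : Interp E} {φ : D → E}
    (hφ : ∀ p l, M.rel p l → N.rel p (l.map φ)) {v : ℕ → D} {a : Atom} (h : M.Holds v a)
    (hc : ∀ c, cst c ∈ a.2 → φ (M.const c) = N.const c) : N.Holds (φ ∘ v) a := by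
  have hrel := hφ _ _ h
  rw [List.map_map] at hrel
  unfold Interp.Holds
  convert hrel using 1
  refine List.map_congr_left ?_
  rintro (x | c) ht
  · rfl
  · exact (hc c ht).symm

/-! ### The one-step chase -/

/-- A trigger: a rule together with an instantiation of the variables of its body by elements of
`C`. -/
abbrev Trigger (C : Type) (𝓡 : Finset Rule) : Type := Σ R : 𝓡, (vars R.1.body → C)

/-- The nulls: every trigger creates one for each existential variable of its rule. -/
abbrev Null (C : Type) (𝓡 : Finset Rule) : Type := Σ τ : Trigger C 𝓡, Rule.existVars τ.1.1

/-- The domain of the one-step chase: the elements of `C`, which name the constants, and the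
nulls. -/
abbrev ChaseDom (C : Type) (𝓡 : Finset Rule) : Type := C ⊕ Null C 𝓡

section Chase

variable {C : Type} {𝓡 : Finset Rule}

open Classical in
/-- The instantiation of the variables of the rule of a trigger. Variables that do not occur in the
rule get an arbitrary value. -/
noncomputable def Trigger.assign (κ : ℕ → C) (τ : Trigger C 𝓡) (x : ℕ) : ChaseDom C 𝓡 :=
  if h : x ∈ vars τ.1.1.body then Sum.inl (τ.2 ⟨x, h⟩)
  else if h : x ∈ Rule.existVars τ.1.1 then Sum.inr ⟨τ, x, h⟩
  else Sum.inl (κ 0)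

/-- The instantiation of the terms of the rule of a trigger. -/
noncomputable def Trigger.eval (κ : ℕ → C) (τ : Trigger C 𝓡) : Term → ChaseDom C 𝓡 :=
  Sum.elim (τ.assign κ) (Sum.inl ∘ κ)

/-- The tuple `l` belongs to the image of the fact base `F` under `κ`. -/
def InFacts {N : Type} (κ : ℕ → C) (F : Finset Fact) (p : ℕ) (l : List (C ⊕ N)) : Prop :=
  ∃ f ∈ F, f.1 = p ∧ l = f.2.map (Sum.inl ∘ κ)

/-- A trigger is active if it maps the body of its rule to facts. -/
def Trigger.Active (κ : ℕ → C) (F : Finset Fact) (τ : Trigger C 𝓡) : Prop :=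
  ∀ a ∈ τ.1.1.body, InFacts κ F a.1 (a.2.map (τ.eval κ))

/-- The tuple `l` belongs to the instance of the head of the rule given by the trigger. -/
def Trigger.Produces (κ : ℕ → C) (τ : Trigger C 𝓡) (p : ℕ) (l : List (ChaseDom C 𝓡)) : Prop :=
  ∃ a ∈ τ.1.1.head, a.1 = p ∧ l = a.2.map (τ.eval κ)

/-- The one-step chase of `(F, 𝓡)`: the facts, together with the instances of the heads of the rules
given by the active triggers. The map `κ` interprets the constants. -/
noncomputable def chase (κ : ℕ → C) (F : Finset Fact) (𝓡 : Finset Rule) :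
    Interp (ChaseDom C 𝓡) where
  const := Sum.inl ∘ κ
  rel p l := InFacts κ F p l ∨ ∃ τ : Trigger C 𝓡, τ.Active κ F ∧ τ.Produces κ p l

/-- The chase of `𝓡` stops after one step on every fact base: the bodies of the rules can be mapped
to the one-step chase through facts only. -/
def OneStep (𝓡 : Finset Rule) : Prop :=
  ∀ (C : Type) (κ : ℕ → C) (F : Finset Fact), ∀ R ∈ 𝓡, ∀ v : ℕ → ChaseDom C 𝓡,
    (∀ a ∈ R.body, (chase κ F 𝓡).Holds v a) →
      ∀ a ∈ R.body, InFacts κ F a.1 (a.2.map ((chase κ F 𝓡).val v))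

variable {κ : ℕ → C} {F : Finset Fact} {τ : Trigger C 𝓡}

namespace Trigger

theorem assign_of_mem_body {x : ℕ} (h : x ∈ vars τ.1.1.body) :
    τ.assign κ x = Sum.inl (τ.2 ⟨x, h⟩) := dif_pos h

theorem assign_of_mem_existVars {x : ℕ} (h : x ∈ Rule.existVars τ.1.1) :
    τ.assign κ x = Sum.inr ⟨τ, x, h⟩ := (dif_neg h.2).trans (dif_pos h)

theorem eval_eq_inr {t : Term} {n : Null C 𝓡} (h : τ.eval κ t = Sum.inr n) :
    n.1 = τ ∧ t = var n.2 := by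
  obtain x | c := t
  · change τ.assign κ x = _ at h
    unfold assign at h
    split_ifs at h
    rw [← Sum.inr.inj h]
    exact ⟨rfl, rfl⟩
  · cases h

theorem Produces.fst_eq {p : ℕ} {l : List (ChaseDom C 𝓡)} (h : τ.Produces κ p l) {n : Null C 𝓡}
    (hn : Sum.inr n ∈ l) : n.1 = τ := by
  obtain ⟨a, -, -, rfl⟩ := h
  obtain ⟨t, -, ht⟩ := List.mem_map.1 hn
  exact (eval_eq_inr ht).1

end Trigger

theorem InFacts.exists_const {N : Type} {p : ℕ} {l : List (C ⊕ N)} (h : InFacts κ F p l)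
    {d : C ⊕ N} (hd : d ∈ l) : ∃ f ∈ F, ∃ c ∈ f.2, d = Sum.inl (κ c) := by
  obtain ⟨f, hf, -, rfl⟩ := h
  obtain ⟨c, hc, rfl⟩ := List.mem_map.1 hd
  exact ⟨f, hf, c, hc, rfl⟩

theorem OneStep.chase_isModel (h𝓡 : OneStep 𝓡) (κ : ℕ → C) (F : Finset Fact) :
    (chase κ F 𝓡).IsModel F 𝓡 := by
  refine ⟨fun f hf => Or.inl ⟨f, hf, rfl, rfl⟩, fun R hR v hv => ?_⟩
  have hfacts := h𝓡 C κ F R hR v hv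
  have hconst : ∀ x : vars R.body, ∃ c, v x = Sum.inl c := by
    rintro ⟨x, a, ha, hx⟩
    obtain ⟨-, -, c, -, hc⟩ := (hfacts a ha).exists_const (List.mem_map_of_mem hx)
    exact ⟨κ c, hc⟩
  choose θ hθ using hconst
  let τ : Trigger C 𝓡 := ⟨⟨R, hR⟩, θ⟩
  have hτ : ∀ x ∈ vars R.body, τ.assign κ x = v x := fun x hx =>
    (Trigger.assign_of_mem_body (τ := τ) hx).trans (hθ ⟨x, hx⟩).symm
  have hactive : τ.Active κ F := fun b hb => by
    rw [show b.2.map (τ.eval κ) = b.2.map ((chase κ F 𝓡).val v) from List.map_congr_left ?_]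
    · exact hfacts b hb
    · rintro (x | c) ht
      exacts [hτ x ⟨b, hb, ht⟩, rfl]
  exact ⟨τ.assign κ, hτ, fun a ha => Or.inr ⟨τ, hactive, a, ha, rfl, rfl⟩⟩

theorem InFacts.map_of_isModel {D N : Type} {M : Interp D} (hM : M.IsModel F 𝓡) {φ : C ⊕ N → D}
    (hφ : ∀ c ∈ constants F 𝓡, φ (Sum.inl (κ c)) = M.const c) {p : ℕ} {l : List (C ⊕ N)}
    (h : InFacts κ F p l) : M.rel p (l.map φ) := by
  obtain ⟨f, hf, rfl, rfl⟩ := h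
  have hrel := hM.1 f hf
  unfold Interp.SatFact at hrel
  rw [List.map_map]
  convert hrel using 1
  exact List.map_congr_left fun c hc => hφ c (Or.inl ⟨f, hf, hc⟩)

theorem Trigger.Active.exists_head {D : Type} {M : Interp D} (hM : M.IsModel F 𝓡) {γ : C → D}
    (hγ : ∀ c ∈ constants F 𝓡, γ (κ c) = M.const c) (hτ : τ.Active κ F) :
    ∃ w : ℕ → D, (∀ x : vars τ.1.1.body, w x = γ (τ.2 x)) ∧ ∀ a ∈ τ.1.1.head, M.Holds w a := by
  let φ : ChaseDom C 𝓡 → D := Sum.elim γ fun _ => M.const 0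
  obtain ⟨w, hw, hhead⟩ := hM.2 τ.1.1 τ.1.2 (φ ∘ τ.assign κ) fun a ha => by
    have hrel := (hτ a ha).map_of_isModel (φ := φ) hM hγ
    rw [List.map_map] at hrel
    unfold Interp.Holds
    convert hrel using 1
    refine List.map_congr_left ?_
    rintro (x | c) ht
    · rfl
    · exact (hγ c (Or.inr ⟨_, τ.1.2, Or.inl ⟨a, ha, ht⟩⟩)).symm
  refine ⟨w, fun x => (hw x x.2).trans ?_, hhead⟩
  simp only [Function.comp, assign_of_mem_body x.2, φ, Sum.elim_inl]

theorem exists_hom_chase {D : Type} {M : Interp D} (hM : M.IsModel F 𝓡) {γ : C → D}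
    (hγ : ∀ c ∈ constants F 𝓡, γ (κ c) = M.const c) :
    ∃ φ : ChaseDom C 𝓡 → D, (∀ c, φ (Sum.inl c) = γ c) ∧
      ∀ p l, (chase κ F 𝓡).rel p l → M.rel p (l.map φ) := by
  have hex (τ : Trigger C 𝓡) : ∃ w : ℕ → D, τ.Active κ F →
      (∀ x : vars τ.1.1.body, w x = γ (τ.2 x)) ∧ ∀ a ∈ τ.1.1.head, M.Holds w a := by
    by_cases hτ : τ.Active κ F
    · exact (hτ.exists_head hM hγ).imp fun w hw _ => hw
    · exact ⟨fun _ => M.const 0, fun h => absurd h hτ⟩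
  choose w hw using hex
  refine ⟨Sum.elim γ fun n => w n.1 n.2, fun _ => rfl, ?_⟩
  rintro p l (h | ⟨τ, hτ, a, ha, rfl, rfl⟩)
  · exact h.map_of_isModel hM hγ
  · have hrel := (hw τ hτ).2 a ha
    unfold Interp.Holds at hrel
    rw [List.map_map]
    convert hrel using 1
    refine List.map_congr_left ?_
    rintro (x | c) ht
    · change Sum.elim γ _ (τ.assign κ x) = w τ x
      by_cases hx : x ∈ vars τ.1.1.body
      · rw [Trigger.assign_of_mem_body hx, (hw τ hτ).1 ⟨x, hx⟩, Sum.elim_inl]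
      · rw [Trigger.assign_of_mem_existVars ⟨⟨a, ha, ht⟩, hx⟩, Sum.elim_inr]
    · exact hγ c (Or.inr ⟨_, τ.1.2, Or.inr ⟨a, ha, ht⟩⟩)

theorem chase_arg_mem_constants {p : ℕ} {l : List (ChaseDom C 𝓡)} (h : (chase κ F 𝓡).rel p l)
    {d : C} (hd : Sum.inl d ∈ l) : d ∈ κ '' constants F 𝓡 := by
  have hfacts {p l} (h : InFacts κ F p l) (hd : Sum.inl (β := Null C 𝓡) d ∈ l) :
      d ∈ κ '' constants F 𝓡 := by
    obtain ⟨f, hf, c, hc, hd⟩ := h.exists_const hd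
    exact ⟨c, Or.inl ⟨f, hf, hc⟩, (Sum.inl.inj hd).symm⟩
  obtain h | ⟨τ, hτ, a, ha, rfl, rfl⟩ := h
  · exact hfacts h hd
  · obtain ⟨x | c, ht, hv⟩ := List.mem_map.1 hd
    · by_cases hx : x ∈ vars τ.1.1.body
      · obtain ⟨b, hb, hxb⟩ := hx
        exact hfacts (hτ b hb) (List.mem_map.2 ⟨var x, hxb, hv⟩)
      · cases (Trigger.assign_of_mem_existVars ⟨⟨a, ha, ht⟩, hx⟩).symm.trans hv
    · exact ⟨c, Or.inr ⟨_, τ.1.2, Or.inr ⟨a, ha, ht⟩⟩, Sum.inl.inj hv⟩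

end Chase

theorem OneStep.mem_fes {𝓡 : Finset Rule} (h𝓡 : OneStep 𝓡) : 𝓡 ∈ fes := by
  intro F
  obtain ⟨B, hB⟩ := (finite_constants F 𝓡).bddAbove
  -- All the constants that do not occur in `(F, 𝓡)` may share one element, as no tuple contains it.
  let κ (c : ℕ) : Fin (B + 2) := Fin.ofNat (B + 2) (min c (B + 1))
  have hκ : ∀ c, (κ c : ℕ) = min c (B + 1) := fun c => Nat.mod_eq_of_lt (by omega)
  have hmodel := h𝓡.chase_isModel κ F
  refine ⟨_, inferInstance, chase κ F 𝓡, hmodel,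
    fun Q => ⟨fun ⟨v, hv⟩ D M hM => ?_, fun h => h _ _ hmodel⟩⟩
  obtain ⟨φ, hφ, hhom⟩ := exists_hom_chase (κ := κ) (γ := fun i => M.const i) hM fun c hc => by
    rw [hκ, min_eq_left ((hB hc).trans B.le_succ)]
  refine ⟨φ ∘ v, fun a ha => (hv a ha).of_hom hhom fun c hc => (hφ _).trans ?_⟩
  obtain ⟨b, hb, hbc⟩ := chase_arg_mem_constants (hv a ha) (List.mem_map.2 ⟨cst c, hc, rfl⟩)
  have hbB := hB hb
  have hmin := congrArg Fin.val hbc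
  rw [hκ, hκ] at hmin
  rw [hκ, show min c (B + 1) = c by omega]

/-! ### Soundness of rewriting -/

theorem Interp.holds_substAtom_iff {D : Type} {M : Interp D} {v w : ℕ → D} {σ : Term → Term}
    {a : Atom} (h : ∀ t ∈ a.2, M.val w t = M.val v (σ t)) :
    M.Holds v (substAtom σ a) ↔ M.Holds w a := by
  simp only [Interp.Holds, substAtom, List.map_map]
  rw [List.map_congr_left h]
  rfl

theorem mem_subst {σ : Term → Term} {A : Finset Atom} {b : Atom} :
    b ∈ subst σ A ↔ ∃ a ∈ A, substAtom σ a = b := Finset.mem_image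

theorem mem_terms_subst {σ : Term → Term} {A : Finset Atom} {t : Term} :
    t ∈ terms (subst σ A) ↔ ∃ u ∈ terms A, σ u = t := by
  simp only [terms, Set.mem_ofPred_eq, mem_subst]
  constructor
  · rintro ⟨_, ⟨a, ha, rfl⟩, ht⟩
    obtain ⟨u, hu, rfl⟩ := List.mem_map.1 ht
    exact ⟨u, ⟨a, ha, hu⟩, rfl⟩
  · rintro ⟨u, ⟨a, ha, hu⟩, rfl⟩
    exact ⟨_, ⟨a, ha, rfl⟩, List.mem_map_of_mem hu⟩

theorem vars_subst_map (ρ : ℕ → ℕ) (A : Finset Atom) :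
    vars (subst (Sum.map ρ id) A) = ρ '' vars A := by
  ext y
  simp [vars, mem_terms_subst]

namespace Rule

theorem body_rename (ρ : ℕ → ℕ) (R : Rule) :
    (R.rename ρ).body = subst (Sum.map ρ id) R.body := by
  ext a
  simp [rename, body, subst]

theorem head_rename (ρ : ℕ → ℕ) (R : Rule) :
    (R.rename ρ).head = subst (Sum.map ρ id) R.head := by
  ext a
  simp [rename, head, subst]

theorem existVars_rename {ρ : ℕ → ℕ} (hρ : Function.Injective ρ) (R : Rule) :
    (R.rename ρ).existVars = ρ '' R.existVars := by
  rw [existVars, existVars, body_rename, head_rename, vars_subst_map, vars_subst_map,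
    Set.image_sdiff hρ]

end Rule

theorem Interp.SatRule.rename {D : Type} {M : Interp D} {R : Rule} (h : M.SatRule R) {ρ : ℕ → ℕ}
    (hρ : Function.Injective ρ) : M.SatRule (R.rename ρ) := by
  intro v hv
  rw [Rule.body_rename] at hv
  obtain ⟨w, hwv, hw⟩ := h (v ∘ ρ) fun a ha =>
    (Interp.holds_substAtom_iff (by rintro (x | c) _ <;> rfl)).1 (hv _ (mem_subst.2 ⟨a, ha, rfl⟩))
  refine ⟨Function.extend ρ w v, ?_, ?_⟩
  · rw [Rule.body_rename, vars_subst_map]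
    rintro _ ⟨x, hx, rfl⟩
    rw [hρ.extend_apply]
    exact hwv x hx
  · rw [Rule.head_rename]
    intro b hb
    obtain ⟨a, ha, rfl⟩ := mem_subst.1 hb
    refine (Interp.holds_substAtom_iff ?_).2 (hw a ha)
    rintro (x | c) _
    · exact (hρ.extend_apply w v x).symm
    · rfl

/-- The existential variables of `R` in `T` whose class for `P` contains `t`. -/
def existClass (R : Rule) (T : Set Term) (P : Setoid Term) (t : Term) : Set ℕ :=
  {z ∈ R.existVars | var z ∈ T ∧ P (var z) t}

open Classical in
/-- The labelling of terms that agrees with `w` on the classes of the existential variables of `R`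
in `T` and with `e` elsewhere. -/
noncomputable def glue {D : Type} (R : Rule) (T : Set Term) (P : Setoid Term) (w : ℕ → D)
    (e : Term → D) (t : Term) : D :=
  if h : (existClass R T P t).Nonempty then w h.some else e t

section Glue

variable {D : Type} {R : Rule} {T : Set Term} {P : Setoid Term} {w : ℕ → D} {e : Term → D}

theorem glue_of_eq_empty {t : Term} (h : existClass R T P t = ∅) : glue R T P w e t = e t :=
  dif_neg (Set.not_nonempty_iff_eq_empty.2 h)

theorem glue_congr (he : ∀ t u, P t u → e t = e u) {t u : Term} (h : P t u) :
    glue R T P w e t = glue R T P w e u := by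
  have hclass : existClass R T P t = existClass R T P u := by
    ext z
    exact and_congr_right fun _ => and_congr_right fun _ =>
      ⟨fun hz => P.trans hz h, fun hz => P.trans hz (P.symm h)⟩
  unfold glue
  rw [he t u h]
  generalize existClass R T P t = S at hclass
  rw [hclass]

end Glue

namespace IsPieceUnifier

variable {Q Q' H' : Finset Atom} {R : Rule} {P : Setoid Term} {σ : Term → Term}
  (hU : IsPieceUnifier Q R Q' H' P) (hdis : Disjoint R.vars (vars Q))

include hU

theorem eq_or_mem_vars {z : ℕ} {t : Term} (hz : z ∈ existClass R (terms (Q' ∪ H')) P t) :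
    t = var z ∨ ∃ x, t = var x ∧ x ∈ vars Q' ∧ x ∉ vars (Q \ Q') :=
  or_iff_not_imp_left.2 (hU.exist z hz.1 hz.2.1 t hz.2.2)

theorem existClass_cst (c : ℕ) : existClass R (terms (Q' ∪ H')) P (cst c) = ∅ := by
  refine Set.eq_empty_of_forall_notMem fun z hz => ?_
  obtain h | ⟨x, h, -⟩ := hU.eq_or_mem_vars hz <;> cases h

include hdis

theorem eq_of_mem_existClass {z : ℕ} {t : Term} (ht : ∀ y, t = var y → y ∈ R.vars)
    (hz : z ∈ existClass R (terms (Q' ∪ H')) P t) : t = var z := by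
  obtain h | ⟨x, rfl, ⟨a, ha, hx⟩, -⟩ := hU.eq_or_mem_vars hz
  · exact h
  · exact (hdis.le_bot ⟨ht x rfl, a, hU.subset_query ha, hx⟩).elim

theorem subsingleton_existClass (t : Term) :
    (existClass R (terms (Q' ∪ H')) P t).Subsingleton := by
  intro z hz z' hz'
  have h : var z' = var z := hU.eq_of_mem_existClass hdis
    (fun y hy => Sum.inl.inj hy ▸ Or.inr hz'.1.1) ⟨hz.1, hz.2.1, P.trans hz.2.2 (P.symm hz'.2.2)⟩
  exact (Sum.inl.inj h).symm

theorem existClass_eq_empty {t : Term} (ht : t ∈ terms (Q \ Q')) :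
    existClass R (terms (Q' ∪ H')) P t = ∅ := by
  refine Set.eq_empty_of_forall_notMem fun z hz => ?_
  obtain rfl | ⟨x, rfl, -, hx⟩ := hU.eq_or_mem_vars hz
  · obtain ⟨a, ha, hza⟩ := ht
    exact hdis.le_bot ⟨Or.inr hz.1.1, a, (Finset.mem_sdiff.1 ha).1, hza⟩
  · exact hx ht

variable {D : Type} {M : Interp D} {v w : ℕ → D}

theorem glue_eq_val_head (hσ : ObtainedFrom σ P)
    (hw : ∀ x ∈ vars R.body, w x = M.val v (σ (var x))) {t : Term} (ht : t ∈ terms H') :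
    glue R (terms (Q' ∪ H')) P w (M.val v ∘ σ) t = M.val w t := by
  obtain ⟨b, hb, htb⟩ := ht
  obtain y | c := t
  · have hy : y ∈ vars R.head := ⟨b, hU.subset_head hb, htb⟩
    by_cases hyb : y ∈ vars R.body
    · rw [glue_of_eq_empty]
      · exact (hw y hyb).symm
      · refine Set.eq_empty_of_forall_notMem fun z hz => hz.1.2 ?_
        have h := hU.eq_of_mem_existClass hdis (fun x hx => Sum.inl.inj hx ▸ Or.inl hyb) hz
        rwa [← Sum.inl.inj h]
    · have hmem : y ∈ existClass R (terms (Q' ∪ H')) P (var y) :=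
        ⟨⟨hy, hyb⟩, ⟨b, Finset.mem_union_right _ hb, htb⟩, P.refl _⟩
      have hne : (existClass R (terms (Q' ∪ H')) P (var y)).Nonempty := ⟨y, hmem⟩
      exact (dif_pos hne).trans
        (congrArg w (hU.subsingleton_existClass hdis _ hne.some_mem hmem))
  · rw [glue_of_eq_empty (hU.existClass_cst c), Function.comp, hσ.2.2]
    rfl

theorem satCQ (hσ : ObtainedFrom σ P) (hw : ∀ x ∈ vars R.body, w x = M.val v (σ (var x)))
    (hhead : ∀ a ∈ R.head, M.Holds w a) (hrest : ∀ a ∈ Q \ Q', M.Holds v (substAtom σ a)) :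
    M.SatCQ Q := by
  let e : Term → D := glue R (terms (Q' ∪ H')) P w (M.val v ∘ σ)
  have hval : M.val (fun x => e (var x)) = e := by
    funext t
    obtain x | c := t
    · rfl
    · refine (Eq.trans (glue_of_eq_empty (hU.existClass_cst c)) ?_).symm
      rw [Function.comp, hσ.2.2]
      rfl
  have hclass : e ∘ σ = e := funext fun t =>
    (glue_congr (fun t u h => congrArg (M.val v) (hσ.1 t u h)) (hσ.2.1 t)).symm
  refine ⟨fun x => e (var x), fun a ha => ?_⟩
  by_cases haQ' : a ∈ Q'
  · have hmem : substAtom σ a ∈ subst σ H' := by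
      rw [hU.unify σ hσ]
      exact mem_subst.2 ⟨a, haQ', rfl⟩
    obtain ⟨b, hb, hba⟩ := mem_subst.1 hmem
    have hargs : a.2.map e = b.2.map (M.val w) := calc
      a.2.map e = (substAtom σ a).2.map e := by rw [substAtom, List.map_map, hclass]
      _ = b.2.map e := by rw [← hba, substAtom, List.map_map, hclass]
      _ = b.2.map (M.val w) := List.map_congr_left fun t ht =>
        hU.glue_eq_val_head hdis hσ hw ⟨b, hb, ht⟩
    have hpred : b.1 = a.1 := (Prod.ext_iff.1 hba).1
    rw [Interp.Holds, hval, hargs, ← hpred]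
    exact hhead b (hU.subset_head hb)
  · have haQ := Finset.mem_sdiff.2 ⟨ha, haQ'⟩
    refine (Interp.holds_substAtom_iff fun t ht => ?_).1 (hrest a haQ)
    rw [hval]
    exact glue_of_eq_empty (hU.existClass_eq_empty hdis ⟨a, haQ, ht⟩)

end IsPieceUnifier

theorem DirectRewriting.sound {R : Rule} {Q Q₁ : CQ} (h : DirectRewriting R Q Q₁) {D : Type}
    {M : Interp D} (hR : M.SatRule R) (hQ₁ : M.SatCQ Q₁) : M.SatCQ Q := by
  obtain ⟨ρ, hρ, hdis, Q', H', P, σ, hU, -, hσ, rfl⟩ := h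
  obtain ⟨v, hv⟩ := hQ₁
  have hval (t : Term) : M.val (fun x => M.val v (σ (var x))) t = M.val v (σ t) := by
    obtain x | c := t
    · rfl
    · rw [hσ.2.2]
      rfl
  obtain ⟨w, hw, hhead⟩ := hR.rename hρ _ fun a ha =>
    (Interp.holds_substAtom_iff fun t _ => hval t).1
      (hv _ (Finset.mem_union_right _ (mem_subst.2 ⟨a, ha, rfl⟩)))
  exact hU.satCQ hdis hσ hw hhead fun a ha =>
    hv _ (Finset.mem_union_left _ (mem_subst.2 ⟨a, ha, rfl⟩))

theorem IsRewriting.sound {𝓡 : Finset Rule} {Q Q' : CQ} (h : IsRewriting 𝓡 Q Q') {D : Type}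
    {M : Interp D} (hM : ∀ R ∈ 𝓡, M.SatRule R) (hQ' : M.SatCQ Q') : M.SatCQ Q := by
  induction h with
  | refl => exact hQ'
  | tail _ hstep ih =>
    obtain ⟨R, hR, hrw⟩ := hstep
    exact ih (hrw.sound (hM R hR) hQ')

/-! ### Completeness of rewriting -/

theorem Admissible.exists_obtainedFrom {P : Setoid Term} (hP : Admissible P) :
    ∃ σ, ObtainedFrom σ P := by
  classical
  refine ⟨fun t => if h : ∃ c, P t (cst c) then cst h.choose else (Quotient.mk P t).out,
    fun t u htu => ?_, fun t => ?_, fun c => ?_⟩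
  · have hconst : ∀ c, P t (cst c) ↔ P u (cst c) := fun c =>
      ⟨P.trans (P.symm htu), P.trans htu⟩
    have hquot : Quotient.mk P t = Quotient.mk P u := Quotient.sound htu
    simp only [hconst, hquot]
  · dsimp only
    split_ifs with h
    · exact h.choose_spec
    · exact P.symm (Quotient.mk_out t)
  · have h : ∃ d, P (cst c) (cst d) := ⟨c, P.refl _⟩
    exact (dif_pos h).trans (congrArg cst (hP _ _ h.choose_spec).symm)

section Kernel

variable {D : Type}

/-- The partition of `T` into the fibres of `f`. -/
def kernelOn (f : Term → D) (T : Set Term) : Setoid Term where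
  r t u := t = u ∨ t ∈ T ∧ u ∈ T ∧ f t = f u
  iseqv := by
    refine ⟨fun _ => Or.inl rfl, ?_, ?_⟩
    · rintro t u (rfl | ⟨ht, hu, h⟩)
      exacts [Or.inl rfl, Or.inr ⟨hu, ht, h.symm⟩]
    · rintro t u s (rfl | ⟨ht, hu, h⟩) (rfl | ⟨hu', hs, h'⟩)
      exacts [Or.inl rfl, Or.inr ⟨hu', hs, h'⟩, Or.inr ⟨ht, hu, h⟩, Or.inr ⟨ht, hs, h.trans h'⟩]

/-- The atom of elements of `D` that `f` makes of an atom of terms. -/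
def label (f : Term → D) (a : Atom) : ℕ × List D := (a.1, a.2.map f)

variable {f : Term → D} {T : Set Term} {σ : Term → Term}

theorem eq_of_kernelOn {t u : Term} (h : kernelOn f T t u) : f t = f u := by
  obtain rfl | ⟨-, -, h⟩ := h
  exacts [rfl, h]

theorem ObtainedFrom.eq_or_mem (hσ : ObtainedFrom σ (kernelOn f T)) (t : Term) :
    σ t = t ∨ σ t ∈ T :=
  (hσ.2.1 t).imp Eq.symm fun h => h.2.1

theorem ObtainedFrom.label_substAtom (hσ : ObtainedFrom σ (kernelOn f T)) (a : Atom) :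
    label f (substAtom σ a) = label f a := by
  simp only [label, substAtom, List.map_map, Prod.mk.injEq, true_and]
  exact List.map_congr_left fun t _ => (eq_of_kernelOn (hσ.2.1 t)).symm

theorem substAtom_eq_of_label_eq (hσ : ∀ t u, kernelOn f T t u → σ t = σ u) {a b : Atom}
    (ha : ∀ t ∈ a.2, t ∈ T) (hb : ∀ t ∈ b.2, t ∈ T) (h : label f a = label f b) :
    substAtom σ a = substAtom σ b := by
  simp only [label, Prod.mk.injEq, ← List.forall₂_eq_eq_eq, List.forall₂_map_left_iff,
    List.forall₂_map_right_iff] at h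
  simp only [substAtom, Prod.mk.injEq, ← List.forall₂_eq_eq_eq, List.forall₂_map_left_iff,
    List.forall₂_map_right_iff]
  refine ⟨h.1, List.forall₂_iff_get.2 ⟨h.2.length_eq, fun i hi hj => hσ _ _ (Or.inr
    ⟨ha _ (List.get_mem _ _), hb _ (List.get_mem _ _), (List.forall₂_iff_get.1 h.2).2 i hi hj⟩)⟩⟩

end Kernel

section PieceUnifier

variable {D : Type} {f : Term → D} {Z : Set D} {Q Q' : Finset Atom} {R : Rule}

/-- The labelling `f` of the terms sends the existential variables of `R` to distinct elements of
the set `Z` of nulls, sends no other term of the head to `Z`, and separates the constants. -/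
structure IsNullLabelling (f : Term → D) (Z : Set D) (R : Rule) : Prop where
  cst_injective : Function.Injective fun c => f (cst c)
  cst_notMem : ∀ c, f (cst c) ∉ Z
  injOn : Set.InjOn (fun z => f (var z)) R.existVars
  mapsTo : Set.MapsTo (fun z => f (var z)) R.existVars Z
  exists_eq_var : ∀ t ∈ terms R.head, f t ∈ Z → ∃ z ∈ R.existVars, t = var z

/-- The terms that `Q'` shares with the rest of `Q` are not labelled by nulls. -/
def IsClosedIn (f : Term → D) (Z : Set D) (Q Q' : Finset Atom) : Prop :=
  ∀ t ∈ terms Q', f t ∈ Z → t ∉ terms (Q \ Q')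

open Classical in
/-- The atoms of the head of `R` that have the label of an atom of `Q'`. -/
noncomputable def matchedHead (f : Term → D) (R : Rule) (Q' : Finset Atom) : Finset Atom :=
  R.head.filter fun b => ∃ a ∈ Q', label f b = label f a

theorem mem_matchedHead {b : Atom} :
    b ∈ matchedHead f R Q' ↔ b ∈ R.head ∧ ∃ a ∈ Q', label f b = label f a := by
  simp only [matchedHead, Finset.mem_filter]

/-- The partition of the terms of `Q'` and of the matched head atoms by their labels. -/
def labelPartition (f : Term → D) (R : Rule) (Q' : Finset Atom) : Setoid Term :=
  kernelOn f (terms (Q' ∪ matchedHead f R Q'))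

theorem IsNullLabelling.isPieceUnifier (hf : IsNullLabelling f Z R) (hQ' : Q' ⊆ Q)
    (hne : Q'.Nonempty) (hclosed : IsClosedIn f Z Q Q')
    (hmatch : ∀ a ∈ Q', ∃ b ∈ R.head, label f b = label f a) :
    IsPieceUnifier Q R Q' (matchedHead f R Q') (labelPartition f R Q') where
  subset_query := hQ'
  nonempty := hne
  subset_head _ hb := (mem_matchedHead.1 hb).1
  partition t u h := h.imp id fun h => ⟨h.1, h.2.1⟩
  admissible c d h := hf.cst_injective (eq_of_kernelOn h)
  unify σ hσ := by
    have hunify {a b : Atom} (ha : a ∈ Q') (hb : b ∈ matchedHead f R Q')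
        (h : label f b = label f a) : substAtom σ b = substAtom σ a :=
      substAtom_eq_of_label_eq hσ.1 (fun t ht => ⟨b, Finset.mem_union_right _ hb, ht⟩)
        (fun t ht => ⟨a, Finset.mem_union_left _ ha, ht⟩) h
    ext c
    simp only [mem_subst]
    constructor
    · rintro ⟨b, hb, rfl⟩
      obtain ⟨a, ha, h⟩ := (mem_matchedHead.1 hb).2
      exact ⟨a, ha, (hunify ha hb h).symm⟩
    · rintro ⟨a, ha, rfl⟩
      obtain ⟨b, hb, h⟩ := hmatch a ha
      have hb' := mem_matchedHead.2 ⟨hb, a, ha, h⟩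
      exact ⟨b, hb', hunify ha hb' h⟩
  exist z hz _ t hzt htz := by
    obtain ⟨-, ⟨a, ha, hta⟩, hlabel⟩ := hzt.resolve_left (Ne.symm htz)
    have htZ : f t ∈ Z := hlabel ▸ hf.mapsTo hz
    obtain ha | ha := Finset.mem_union.1 ha
    · obtain x | c := t
      · exact ⟨x, rfl, ⟨a, ha, hta⟩, hclosed _ ⟨a, ha, hta⟩ htZ⟩
      · exact absurd htZ (hf.cst_notMem c)
    · obtain ⟨y, hy, rfl⟩ := hf.exists_eq_var t ⟨a, (mem_matchedHead.1 ha).1, hta⟩ htZ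
      exact absurd (congrArg var (hf.injOn hz hy hlabel)).symm htz

theorem IsNullLabelling.isPiece (hf : IsNullLabelling f Z R) (hdis : Disjoint R.vars (vars Q))
    (hQ' : Q' ⊆ Q) (hmatch : ∀ a ∈ Q', ∃ b ∈ R.head, label f b = label f a)
    (hmin : ∀ Q'' ⊂ Q', Q''.Nonempty → ¬ IsClosedIn f Z Q Q'') :
    IsPiece Q R Q' (labelPartition f R Q') := by
  rintro ⟨Q'', hss, hne, hexist⟩
  refine hmin Q'' hss hne fun t ht htZ => ?_
  obtain ⟨a, ha, hta⟩ := ht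
  have haQ' := hss.subset ha
  obtain ⟨b, hb, hba⟩ := hmatch a haQ'
  have hb' : b ∈ matchedHead f R Q' := mem_matchedHead.2 ⟨hb, a, haQ', hba⟩
  have hargs : b.2.map f = a.2.map f := (Prod.ext_iff.1 hba).2
  obtain ⟨u, hu, hut⟩ := List.mem_map.1 (hargs ▸ List.mem_map_of_mem hta)
  obtain ⟨z, hz, rfl⟩ := hf.exists_eq_var u ⟨b, hb, hu⟩ (hut ▸ htZ)
  refine hexist z hz t ⟨a, ha, hta⟩ (Or.inr ⟨⟨b, Finset.mem_union_right _ hb', hu⟩,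
    ⟨a, Finset.mem_union_left _ haQ', hta⟩, hut⟩) ?_
  rintro rfl
  exact hdis.le_bot ⟨Or.inr hz.1, a, hQ' haQ', hta⟩

end PieceUnifier

/-- The queries obtained by substitution from subsets of `U`, without new terms. -/
def substImages (U : Finset Atom) : Set CQ :=
  {Q | ∃ A ⊆ U, ∃ σ, Set.MapsTo σ (terms U) (terms U) ∧ Q = subst σ A}

theorem finite_substImages (U : Finset Atom) : (substImages U).Finite := by
  classical
  have : Finite (terms U) := finite_terms U
  let extend (σ : terms U → terms U) (t : Term) : Term :=
    if h : t ∈ terms U then σ ⟨t, h⟩ else t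
  refine (Set.finite_range fun p : {A // A ∈ U.powerset} × (terms U → terms U) =>
    subst (extend p.2) p.1).subset ?_
  rintro _ ⟨A, hA, σ, hσ, rfl⟩
  refine ⟨⟨⟨A, Finset.mem_powerset.2 hA⟩, hσ.restrict⟩, Finset.image_congr fun a ha => ?_⟩
  exact congrArg (Prod.mk a.1) (List.map_congr_left fun t ht => dif_pos ⟨a, hA ha, ht⟩)

section ChaseRewriting

variable {F : Finset Fact} {𝓡 : Finset Rule} {κ : ℕ → ℕ}

/-- The nulls created by a trigger. -/
def Trigger.nulls {C : Type} (τ : Trigger C 𝓡) : Set (ChaseDom C 𝓡) :=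
  {d | ∃ n : Null C 𝓡, n.1 = τ ∧ d = Sum.inr n}

/-- The variant by `ρ` of the rule of a trigger. -/
abbrev Trigger.variant {C : Type} (τ : Trigger C 𝓡) (ρ : ℕ → ℕ) : Rule := Rule.rename ρ τ.1.1

open Classical in
/-- The atoms of `Q` that the labelling `f` does not map to facts. -/
noncomputable def nonFacts (F : Finset Fact) (f : Term → ChaseDom ℕ 𝓡) (Q : CQ) : Finset Atom :=
  Q.filter fun a => ¬ InFacts id F a.1 (a.2.map f)

theorem mem_nonFacts {f : Term → ChaseDom ℕ 𝓡} {Q : CQ} {a : Atom} :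
    a ∈ nonFacts F f Q ↔ a ∈ Q ∧ ¬ InFacts id F a.1 (a.2.map f) := by
  simp only [nonFacts, Finset.mem_filter]

/-- The atoms of `Q` together with those of the variants given by `ρ` of the rules of `𝓡`. -/
def stepAtoms (ρ : ℕ → ℕ) (𝓡 : Finset Rule) (Q : CQ) : Finset Atom :=
  Q ∪ 𝓡.biUnion fun R => (R.rename ρ).body ∪ (R.rename ρ).head

theorem disjoint_vars_rename {ρ : ℕ → ℕ} {Q : CQ} (hρQ : ∀ x, ρ x ∉ vars Q) (R : Rule) :
    Disjoint (R.rename ρ).vars (vars Q) := by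
  rw [Set.disjoint_left, Rule.vars, Rule.body_rename, Rule.head_rename, vars_subst_map,
    vars_subst_map, ← Set.image_union]
  rintro _ ⟨x, -, rfl⟩
  exact hρQ x

/-- The labelling `f` extends a homomorphism from `Q` to the one-step chase by the instantiation
that the active trigger `τ` gives to the variant by `ρ` of its rule. -/
structure IsStepLabelling (F : Finset Fact) (τ : Trigger ℕ 𝓡) (ρ : ℕ → ℕ) (Q : CQ)
    (f : Term → ChaseDom ℕ 𝓡) : Prop where
  active : τ.Active id F
  injective : Function.Injective ρ
  notMem_vars : ∀ x, ρ x ∉ vars Q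
  eval_eq : ∀ t, f (Sum.map ρ id t) = τ.eval id t
  rel : ∀ a ∈ Q, (chase id F 𝓡).rel a.1 (a.2.map f)

namespace IsStepLabelling

variable {τ : Trigger ℕ 𝓡} {ρ : ℕ → ℕ} {Q : CQ} {f : Term → ChaseDom ℕ 𝓡}
  (hf : IsStepLabelling F τ ρ Q f)

include hf

theorem label_substAtom (a : Atom) :
    label f (substAtom (Sum.map ρ id) a) = label (τ.eval id) a := by
  simp only [label, substAtom, List.map_map, Prod.mk.injEq, true_and]
  exact List.map_congr_left fun t _ => hf.eval_eq t

theorem isNullLabelling : IsNullLabelling f τ.nulls (τ.variant ρ) where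
  cst_injective c d h :=
    Sum.inl.inj (((hf.eval_eq (cst c)).symm.trans h).trans (hf.eval_eq (cst d)))
  cst_notMem c := by
    rintro ⟨n, -, h⟩
    cases (hf.eval_eq (cst c)).symm.trans h
  injOn := by
    rw [Rule.existVars_rename hf.injective]
    rintro _ ⟨x, hx, rfl⟩ _ ⟨y, hy, rfl⟩ h
    have hxy : τ.assign id x = τ.assign id y :=
      ((hf.eval_eq (var x)).symm.trans h).trans (hf.eval_eq (var y))
    rw [Trigger.assign_of_mem_existVars hx, Trigger.assign_of_mem_existVars hy] at hxy
    exact congrArg ρ (by simpa using hxy)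
  mapsTo := by
    rw [Rule.existVars_rename hf.injective]
    rintro _ ⟨x, hx, rfl⟩
    exact ⟨⟨τ, x, hx⟩, rfl, (hf.eval_eq (var x)).trans (Trigger.assign_of_mem_existVars hx)⟩
  exists_eq_var := by
    rw [Rule.existVars_rename hf.injective, Rule.head_rename]
    rintro t ht ⟨⟨_, z⟩, rfl, h⟩
    obtain ⟨u, -, rfl⟩ := mem_terms_subst.1 ht
    obtain ⟨-, rfl⟩ := Trigger.eval_eq_inr ((hf.eval_eq u).symm.trans h)
    exact ⟨_, ⟨z, z.2, rfl⟩, rfl⟩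

theorem inFacts_of_mem_body {b : Atom} (hb : b ∈ (τ.variant ρ).body) :
    InFacts id F b.1 (b.2.map f) := by
  rw [Rule.body_rename] at hb
  obtain ⟨a, ha, rfl⟩ := mem_subst.1 hb
  have hargs : (substAtom (Sum.map ρ id) a).2.map f = a.2.map (τ.eval id) :=
    (Prod.ext_iff.1 (hf.label_substAtom a)).2
  exact hargs ▸ hf.active a ha

theorem exists_head_label_eq {a : Atom} (ha : τ.Produces id a.1 (a.2.map f)) :
    ∃ b ∈ (τ.variant ρ).head, label f b = label f a := by
  obtain ⟨b, hb, hpred, hargs⟩ := ha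
  refine ⟨substAtom (Sum.map ρ id) b, ?_, (hf.label_substAtom b).trans (Prod.ext hpred hargs.symm)⟩
  rw [Rule.head_rename]
  exact mem_subst.2 ⟨b, hb, rfl⟩

open Classical in
theorem isClosedIn_produced : IsClosedIn f τ.nulls Q
    ((nonFacts F f Q).filter fun a => τ.Produces id a.1 (a.2.map f)) := by
  rintro t - ⟨n, rfl, hn⟩ ⟨b, hb, htb⟩
  obtain ⟨hbQ, hbT⟩ := Finset.mem_sdiff.1 hb
  have hmem : Sum.inr n ∈ b.2.map f := hn ▸ List.mem_map_of_mem htb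
  have hnf : ¬ InFacts id F b.1 (b.2.map f) := fun h => by
    obtain ⟨f, -, c, -, h⟩ := h.exists_const hmem
    cases h
  obtain ⟨τ', -, hτ'⟩ := (hf.rel b hbQ).resolve_left hnf
  obtain rfl := hτ'.fst_eq hmem
  exact hbT (Finset.mem_filter.2 ⟨mem_nonFacts.2 ⟨hbQ, hnf⟩, hτ'⟩)

theorem exists_pieceUnifier {a : Atom} (ha : a ∈ nonFacts F f Q)
    (hτ : τ.Produces id a.1 (a.2.map f)) :
    ∃ Q' ⊆ nonFacts F f Q, Q'.Nonempty ∧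
      IsPieceUnifier Q (τ.variant ρ) Q' (matchedHead f (τ.variant ρ) Q')
        (labelPartition f (τ.variant ρ) Q') ∧
      IsPiece Q (τ.variant ρ) Q' (labelPartition f (τ.variant ρ) Q') := by
  classical
  obtain ⟨Q', hQ', hmin⟩ := exists_minimal_le_of_wellFoundedLT
    (fun X => X.Nonempty ∧ IsClosedIn f τ.nulls Q X) _
    ⟨⟨a, Finset.mem_filter.2 ⟨ha, hτ⟩⟩, hf.isClosedIn_produced⟩
  have hnonFacts : Q' ⊆ nonFacts F f Q := fun a ha => (Finset.mem_filter.1 (hQ' ha)).1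
  have hQ : Q' ⊆ Q := fun a ha => (mem_nonFacts.1 (hnonFacts ha)).1
  have hmatch : ∀ a ∈ Q', ∃ b ∈ (τ.variant ρ).head, label f b = label f a :=
    fun a ha => hf.exists_head_label_eq (Finset.mem_filter.1 (hQ' ha)).2
  exact ⟨Q', hnonFacts, hmin.prop.1,
    hf.isNullLabelling.isPieceUnifier hQ hmin.prop.1 hmin.prop.2 hmatch,
    hf.isNullLabelling.isPiece (disjoint_vars_rename hf.notMem_vars _) hQ hmatch
      fun X hX hne hclosed => hmin.not_prop_of_lt hX ⟨hne, hclosed⟩⟩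

omit hf in
theorem label_args_subst {Q' : Finset Atom} {σ : Term → Term}
    (hσ : ObtainedFrom σ (labelPartition f (τ.variant ρ) Q')) (a : Atom) :
    (substAtom σ a).2.map f = a.2.map f :=
  (Prod.ext_iff.1 (ObtainedFrom.label_substAtom hσ a)).2

variable {Q' : Finset Atom} {σ : Term → Term}
  (hσ : ObtainedFrom σ (labelPartition f (τ.variant ρ) Q'))

include hσ

theorem rel_of_mem_subst {b : Atom} (hb : b ∈ subst σ (Q \ Q' ∪ (τ.variant ρ).body)) :
    (chase id F 𝓡).rel b.1 (b.2.map f) := by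
  obtain ⟨a, ha, rfl⟩ := mem_subst.1 hb
  rw [label_args_subst hσ]
  exact (Finset.mem_union.1 ha).elim (fun ha => hf.rel a (Finset.mem_sdiff.1 ha).1)
    fun ha => Or.inl (hf.inFacts_of_mem_body ha)

theorem card_nonFacts_subst_lt (hQ' : Q' ⊆ nonFacts F f Q) (hne : Q'.Nonempty) :
    (nonFacts F f (subst σ (Q \ Q' ∪ (τ.variant ρ).body))).card < (nonFacts F f Q).card := by
  have hsub : nonFacts F f (subst σ (Q \ Q' ∪ (τ.variant ρ).body)) ⊆
      subst σ (nonFacts F f Q \ Q') := by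
    intro b hb
    obtain ⟨hb, hbF⟩ := mem_nonFacts.1 hb
    obtain ⟨a, ha, rfl⟩ := mem_subst.1 hb
    rw [label_args_subst hσ] at hbF
    obtain ha | ha := Finset.mem_union.1 ha
    · obtain ⟨haQ, haQ'⟩ := Finset.mem_sdiff.1 ha
      exact mem_subst.2 ⟨a, Finset.mem_sdiff.2 ⟨mem_nonFacts.2 ⟨haQ, hbF⟩, haQ'⟩, rfl⟩
    · exact absurd (hf.inFacts_of_mem_body ha) hbF
  calc _ ≤ (nonFacts F f Q \ Q').card := (Finset.card_le_card hsub).trans Finset.card_image_le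
    _ < (nonFacts F f Q).card := Finset.card_lt_card (Finset.sdiff_ssubset hQ' hne)

omit hf in
theorem subst_mem_substImages (hQ' : Q' ⊆ Q) :
    subst σ (Q \ Q' ∪ (τ.variant ρ).body) ∈ substImages (stepAtoms ρ 𝓡 Q) := by
  have hrule : (τ.variant ρ).body ∪ (τ.variant ρ).head ⊆ stepAtoms ρ 𝓡 Q :=
    fun b hb => Finset.mem_union_right _ (Finset.mem_biUnion.2 ⟨_, τ.1.2, hb⟩)
  refine ⟨_, ?_, σ, fun t ht => ?_, rfl⟩
  · exact Finset.union_subset (Finset.sdiff_subset.trans Finset.subset_union_left)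
      (Finset.subset_union_left.trans hrule)
  · obtain h | ⟨b, hb, hbt⟩ := ObtainedFrom.eq_or_mem hσ t
    · rwa [h]
    · refine ⟨b, ?_, hbt⟩
      obtain hb | hb := Finset.mem_union.1 hb
      · exact Finset.mem_union_left _ (hQ' hb)
      · exact hrule (Finset.mem_union_right _ (mem_matchedHead.1 hb).1)

omit hσ in
theorem exists_directRewriting {a : Atom} (ha : a ∈ nonFacts F f Q)
    (hτ : τ.Produces id a.1 (a.2.map f)) :
    ∃ Q₁ ∈ substImages (stepAtoms ρ 𝓡 Q), DirectRewriting τ.1.1 Q Q₁ ∧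
      (∀ b ∈ Q₁, (chase id F 𝓡).rel b.1 (b.2.map f)) ∧
      (nonFacts F f Q₁).card < (nonFacts F f Q).card := by
  obtain ⟨Q', hQ', hne, hU, hpiece⟩ := hf.exists_pieceUnifier ha hτ
  obtain ⟨σ, hσ⟩ := hU.admissible.exists_obtainedFrom
  exact ⟨subst σ (Q \ Q' ∪ (τ.variant ρ).body), subst_mem_substImages hσ hU.subset_query,
    ⟨ρ, hf.injective, disjoint_vars_rename hf.notMem_vars _, Q', _, _, σ, hU, hpiece, hσ,
      Finset.image_union ..⟩,
    fun b hb => hf.rel_of_mem_subst hσ hb, hf.card_nonFacts_subst_lt hσ hQ' hne⟩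

end IsStepLabelling

theorem entails_empty_of_nonFacts_eq_empty {Q : CQ} {h : ℕ → ChaseDom ℕ 𝓡}
    (hQ : nonFacts F ((chase id F 𝓡).val h) Q = ∅) : Entails F ∅ Q := by
  intro D M hM
  let φ : ChaseDom ℕ 𝓡 → D := Sum.elim M.const fun _ => M.const 0
  refine ⟨φ ∘ h, fun a ha => ?_⟩
  have hfact : InFacts id F a.1 (a.2.map ((chase id F 𝓡).val h)) := by
    by_contra hfact
    exact Finset.notMem_empty a (hQ ▸ mem_nonFacts.2 ⟨ha, hfact⟩)
  have hrel := hfact.map_of_isModel (φ := φ) hM fun _ _ => rfl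
  rw [List.map_map] at hrel
  unfold Interp.Holds
  convert hrel using 1
  exact List.map_congr_left (by rintro (x | c) _ <;> rfl)

theorem exists_isStepLabelling {τ : Trigger ℕ 𝓡} (hτ : τ.Active id F) {ρ : ℕ → ℕ}
    (hρ : Function.Injective ρ) {Q : CQ} (hρQ : ∀ x, ρ x ∉ vars Q) {h : ℕ → ChaseDom ℕ 𝓡}
    (hh : ∀ a ∈ Q, (chase id F 𝓡).Holds h a) :
    ∃ g : ℕ → ChaseDom ℕ 𝓡, IsStepLabelling F τ ρ Q ((chase id F 𝓡).val g) ∧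
      ∀ a ∈ Q, a.2.map ((chase id F 𝓡).val g) = a.2.map ((chase id F 𝓡).val h) := by
  let g := Function.extend ρ (τ.assign id) h
  have hgQ : ∀ a ∈ Q, a.2.map ((chase id F 𝓡).val g) = a.2.map ((chase id F 𝓡).val h) := by
    refine fun a ha => List.map_congr_left ?_
    rintro (x | c) hx
    · refine Function.extend_apply' _ _ _ ?_
      rintro ⟨y, rfl⟩
      exact hρQ y ⟨a, ha, hx⟩
    · rfl
  refine ⟨g, ⟨hτ, hρ, hρQ, ?_, fun a ha => hgQ a ha ▸ hh a ha⟩, hgQ⟩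
  rintro (x | c)
  · exact hρ.extend_apply _ _ x
  · rfl

theorem exists_rewriting_step {ρ : ℕ → ℕ} (hρ : Function.Injective ρ) {Q : CQ}
    (hρQ : ∀ x, ρ x ∉ vars Q) {h : ℕ → ChaseDom ℕ 𝓡} (hh : ∀ a ∈ Q, (chase id F 𝓡).Holds h a)
    (hne : (nonFacts F ((chase id F 𝓡).val h) Q).Nonempty) :
    ∃ Q₁ ∈ substImages (stepAtoms ρ 𝓡 Q), (∃ R ∈ 𝓡, DirectRewriting R Q Q₁) ∧
      ∃ g : ℕ → ChaseDom ℕ 𝓡, (∀ a ∈ Q₁, (chase id F 𝓡).Holds g a) ∧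
        (nonFacts F ((chase id F 𝓡).val g) Q₁).card <
          (nonFacts F ((chase id F 𝓡).val h) Q).card := by
  obtain ⟨a, ha⟩ := hne
  obtain ⟨haQ, haF⟩ := mem_nonFacts.1 ha
  obtain ⟨τ, hτ, haτ⟩ := (hh a haQ).resolve_left haF
  obtain ⟨g, hg, hgh⟩ := exists_isStepLabelling hτ hρ hρQ hh
  have hnonFacts : nonFacts F ((chase id F 𝓡).val g) Q = nonFacts F ((chase id F 𝓡).val h) Q := by
    ext b
    simp only [mem_nonFacts]
    exact and_congr_right fun hb => by rw [hgh b hb]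
  rw [← hgh a haQ] at haτ
  obtain ⟨Q₁, hQ₁, hdirect, hrel, hlt⟩ := hg.exists_directRewriting (hnonFacts ▸ ha) haτ
  exact ⟨Q₁, hQ₁, ⟨_, τ.1.2, hdirect⟩, g, hrel, hnonFacts ▸ hlt⟩

end ChaseRewriting

theorem exists_injective_notMem_vars (Q : CQ) :
    ∃ ρ : ℕ → ℕ, Function.Injective ρ ∧ ∀ x, ρ x ∉ vars Q := by
  obtain ⟨K, hK⟩ := (finite_vars Q).bddAbove
  refine ⟨(· + (K + 1)), add_left_injective _, fun x hx => ?_⟩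
  have hle : x + (K + 1) ≤ K := hK hx
  omega

theorem exists_finite_rewritings (𝓡 : Finset Rule) (k : ℕ) (Q : CQ) :
    ∃ S : Finset CQ, (∀ Q' ∈ S, IsRewriting 𝓡 Q Q') ∧
      ∀ (F : Finset Fact) (h : ℕ → ChaseDom ℕ 𝓡), (∀ a ∈ Q, (chase id F 𝓡).Holds h a) →
        (nonFacts F ((chase id F 𝓡).val h) Q).card ≤ k → ∃ Q' ∈ S, Entails F ∅ Q' := by
  classical
  -- Every rewriting step lowers the number of atoms that are not mapped to facts.
  induction k generalizing Q with
  | zero =>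
    refine ⟨{Q}, fun Q' hQ' => ?_, fun F h _ hk => ⟨Q, Finset.mem_singleton_self Q, ?_⟩⟩
    · rw [Finset.mem_singleton.1 hQ']
      exact Relation.ReflTransGen.refl
    · exact entails_empty_of_nonFacts_eq_empty (Finset.card_eq_zero.1 (Nat.le_zero.1 hk))
  | succ k ih =>
    choose S hS hScomplete using ih
    obtain ⟨ρ, hρ, hρQ⟩ := exists_injective_notMem_vars Q
    let steps := (finite_substImages (stepAtoms ρ 𝓡 Q)).toFinset.filter
      fun Q₁ => ∃ R ∈ 𝓡, DirectRewriting R Q Q₁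
    refine ⟨insert Q (steps.biUnion S), fun Q' hQ' => ?_, fun F h hh hk => ?_⟩
    · obtain rfl | hQ' := Finset.mem_insert.1 hQ'
      · exact Relation.ReflTransGen.refl
      · obtain ⟨Q₁, hQ₁, hQ'⟩ := Finset.mem_biUnion.1 hQ'
        exact Relation.ReflTransGen.head (Finset.mem_filter.1 hQ₁).2 (hS Q₁ Q' hQ')
    · obtain hempty | hne := (nonFacts F ((chase id F 𝓡).val h) Q).eq_empty_or_nonempty
      · exact ⟨Q, Finset.mem_insert_self _ _, entails_empty_of_nonFacts_eq_empty hempty⟩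
      · obtain ⟨Q₁, hQ₁, hdirect, g, hg, hlt⟩ := exists_rewriting_step hρ hρQ hh hne
        obtain ⟨Q', hQ', hentails⟩ := hScomplete Q₁ F g hg (by omega)
        have hmem : Q₁ ∈ steps :=
          Finset.mem_filter.2 ⟨(Set.Finite.mem_toFinset _).2 hQ₁, hdirect⟩
        exact ⟨Q', Finset.mem_insert_of_mem (Finset.mem_biUnion.2 ⟨Q₁, hmem, hQ'⟩), hentails⟩

theorem OneStep.mem_fus {𝓡 : Finset Rule} (h𝓡 : OneStep 𝓡) : 𝓡 ∈ fus := by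
  intro Q
  obtain ⟨S, hS, hScomplete⟩ := exists_finite_rewritings 𝓡 Q.card Q
  refine ⟨S, hS, fun F => ⟨fun hQ => ?_, ?_⟩⟩
  · obtain ⟨h, hh⟩ := hQ _ _ (h𝓡.chase_isModel id F)
    exact hScomplete F h hh (Finset.card_le_card fun a ha => (mem_nonFacts.1 ha).1)
  · rintro ⟨Q', hQ', hentails⟩ D M hM
    exact (hS Q' hQ').sound hM.2
      (hentails D M ⟨hM.1, fun R hR => absurd hR (Finset.notMem_empty R)⟩)

/-! ### Rules over an encodable type of variables -/

section CodedRule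

variable {V D : Type} [Encodable V]

/-- The list of atoms over the numbered variables that corresponds to a list of constant-free atoms
over the variables in `V`. -/
def codedAtoms (A : List (ℕ × List V)) : List Atom :=
  A.map fun a => (a.1, a.2.map fun x => var (Encodable.encode x))

/-- The existential rule with body `B` and head `H`. -/
def codedRule (B H : List (ℕ × List V)) : Rule := (codedAtoms B, codedAtoms H)

theorem mem_vars_codedAtoms {A : List (ℕ × List V)} {n : ℕ} :
    n ∈ vars (codedAtoms A).toFinset ↔ ∃ a ∈ A, ∃ x ∈ a.2, Encodable.encode x = n := by
  simp [vars, terms, codedAtoms]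

theorem encode_mem_vars_codedAtoms {A : List (ℕ × List V)} {x : V} :
    Encodable.encode x ∈ vars (codedAtoms A).toFinset ↔ ∃ a ∈ A, x ∈ a.2 := by
  simp [mem_vars_codedAtoms]

theorem encode_mem_existVars_codedRule {B H : List (ℕ × List V)} {x : V} :
    Encodable.encode x ∈ Rule.existVars (codedRule B H) ↔
      (∃ a ∈ H, x ∈ a.2) ∧ ¬ ∃ a ∈ B, x ∈ a.2 :=
  and_congr encode_mem_vars_codedAtoms (not_congr encode_mem_vars_codedAtoms)

theorem forall_mem_codedAtoms {M : Interp D} {v : ℕ → D} {A : List (ℕ × List V)} :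
    (∀ a ∈ (codedAtoms A).toFinset, M.Holds v a) ↔
      ∀ a ∈ A, M.rel a.1 (a.2.map (v ∘ Encodable.encode)) := by
  simp only [List.mem_toFinset, codedAtoms, List.forall_mem_map, Interp.Holds, List.map_map]
  rfl

theorem satRule_codedRule {M : Interp D} {B H : List (ℕ × List V)} :
    M.SatRule (codedRule B H) ↔ ∀ u : V → D, (∀ a ∈ B, M.rel a.1 (a.2.map u)) →
      ∃ w : V → D, (∀ a ∈ B, ∀ x ∈ a.2, w x = u x) ∧ ∀ a ∈ H, M.rel a.1 (a.2.map w) := by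
  constructor
  · intro h u hu
    have hv := Function.extend_comp Encodable.encode_injective u fun _ => M.const 0
    set v := Function.extend Encodable.encode u fun _ => M.const 0
    obtain ⟨w, hw, hH⟩ := h v (forall_mem_codedAtoms.2 (by rwa [hv]))
    exact ⟨w ∘ Encodable.encode, fun a ha x hx =>
      (hw _ (encode_mem_vars_codedAtoms.2 ⟨a, ha, hx⟩)).trans (congrFun hv x),
      forall_mem_codedAtoms.1 hH⟩
  · intro h v hv
    obtain ⟨w, hw, hH⟩ := h (v ∘ Encodable.encode) (forall_mem_codedAtoms.1 hv)
    have hext := Function.extend_comp Encodable.encode_injective w v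
    refine ⟨Function.extend Encodable.encode w v, fun n hn => ?_,
      forall_mem_codedAtoms.2 (by rwa [hext])⟩
    obtain ⟨a, ha, x, hx, rfl⟩ := mem_vars_codedAtoms.1 hn
    exact (congrFun hext x).trans (hw a ha x hx)

end CodedRule

/-- The transitivity rule for the binary predicate `p`. -/
def transRule (p : ℕ) : Rule :=
  codedRule [(p, [(0 : Fin 3), 1]), (p, [1, 2])] [(p, [0, 2])]

theorem isTransitivityRule_transRule (p : ℕ) : IsTransitivityRule (transRule p) :=
  ⟨p, Encodable.encode (0 : Fin 3), Encodable.encode (1 : Fin 3), Encodable.encode (2 : Fin 3),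
    by simp, by simp, by simp,
    by simp [transRule, codedRule, codedAtoms, Rule.body],
    by simp [transRule, codedRule, codedAtoms, Rule.head]⟩

theorem satRule_transRule {D : Type} {M : Interp D} {p : ℕ} :
    M.SatRule (transRule p) ↔ ∀ a b c, M.rel p [a, b] → M.rel p [b, c] → M.rel p [a, c] := by
  rw [transRule, satRule_codedRule]
  simp only [List.forall_mem_cons, List.not_mem_nil, false_imp_iff, implies_true, and_true,
    List.map_cons, List.map_nil]
  constructor
  · intro h a b c hab hbc
    obtain ⟨w, ⟨⟨h0, -⟩, -, h2⟩, hw⟩ := h ![a, b, c] ⟨hab, hbc⟩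
    rw [h0, h2] at hw
    exact hw
  · exact fun h u hu => ⟨u, by simp, h _ _ _ hu.1 hu.2⟩

/-! ### Encoding clauses by rules -/

/-- An atom over the relation symbols in `J`, which all have arity `k`, with arguments in `X`. -/
abbrev RelAtom (J : Type) (k : ℕ) (X : Type) : Type := J × (Fin k → X)

/-- Apply a map to the arguments of an atom. -/
def RelAtom.mapArgs {J : Type} {k : ℕ} {X Y : Type} (f : X → Y) (α : RelAtom J k X) :
    RelAtom J k Y := (α.1, f ∘ α.2)

/-- A clause `∀ x y, (B[x, y] → ∃ z, H[x, z])` whose head is a single atom. -/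
structure Clause (J : Type) (k : ℕ) where
  body : List (RelAtom J k ℕ)
  head : RelAtom J k ℕ

namespace Clause

variable {J : Type} {k : ℕ}

/-- The variables of the body of a clause. -/
def bodyVars (γ : Clause J k) : List ℕ := γ.body.flatMap fun α => List.ofFn α.2

/-- The set `T` of true atoms satisfies a clause. -/
def Sat {A : Type} (T : Set (RelAtom J k A)) (γ : Clause J k) : Prop :=
  ∀ v : ℕ → A, (∀ α ∈ γ.body, α.mapArgs v ∈ T) →
    ∃ w : ℕ → A, (∀ x ∈ γ.bodyVars, w x = v x) ∧ γ.head.mapArgs w ∈ T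

theorem mem_bodyVars {γ : Clause J k} {x : ℕ} :
    x ∈ γ.bodyVars ↔ ∃ α ∈ γ.body, ∃ i, α.2 i = x := by
  simp [bodyVars, List.mem_ofFn]

end Clause

section Gadget

variable {J : Type} {k : ℕ} [Encodable J] {X D : Type}

/-- The binary predicate that links the `i`-th argument of an atom with relation symbol `j` to the
object that represents the atom. -/
def edge (j : J) (i : Fin k) : ℕ := Encodable.encode (j, i)

theorem edge_inj {j j' : J} {i i' : Fin k} : edge j i = edge j' i' ↔ j = j' ∧ i = i' := by
  rw [edge, edge, Encodable.encode_inj, Prod.mk.injEq]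

/-- In a structure for the encoding, the object `s` represents the atom `α`: the unary predicate `0`
marks the arguments and the unary predicate `1` marks the objects that represent atoms. -/
def Represents (r : ℕ → List D → Prop) (α : RelAtom J k D) (s : D) : Prop :=
  r 1 [s] ∧ ∀ i, r 0 [α.2 i] ∧ r (edge α.1 i) [α.2 i, s]

/-- The atoms which say that `s` represents `α`. -/
def gadget (α : RelAtom J k X) (s : X) : List (ℕ × List X) :=
  (1, [s]) :: (List.finRange k).flatMap fun i => [(0, [α.2 i]), (edge α.1 i, [α.2 i, s])]

theorem mem_gadget {α : RelAtom J k X} {s : X} {a : ℕ × List X} : a ∈ gadget α s ↔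
    a = (1, [s]) ∨ ∃ i, a = (0, [α.2 i]) ∨ a = (edge α.1 i, [α.2 i, s]) := by
  simp [gadget]

theorem forall_mem_gadget {r : ℕ → List D → Prop} {f : X → D} {α : RelAtom J k X} {s : X} :
    (∀ a ∈ gadget α s, r a.1 (a.2.map f)) ↔ Represents r (α.mapArgs f) (f s) := by
  simp only [gadget, List.forall_mem_cons, List.forall_mem_flatMap, List.mem_finRange,
    List.not_mem_nil, false_imp_iff, implies_true, and_true, true_imp_iff, List.map_cons,
    List.map_nil]
  rfl

/-- The atoms that are represented in an interpretation. -/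
def representedAtoms (J : Type) (k : ℕ) [Encodable J] (M : Interp D) : Set (RelAtom J k D) :=
  {α | ∃ s, Represents M.rel α s}

end Gadget

/-- The variables of the rule that encodes a clause: the variables of the clause, the objects that
represent the atoms of the body, and an intermediate and a final object for the head. -/
inductive RuleVar (J : Type) (k : ℕ)
  | elem (x : ℕ)
  | bodySink (α : RelAtom J k ℕ)
  | headMid
  | headSink
  deriving Encodable

namespace Clause

variable {J : Type} {k : ℕ} [Encodable J] {γ : Clause J k}

/-- The body of the rule that encodes a clause. -/
def ruleBody (γ : Clause J k) : List (ℕ × List (RuleVar J k)) :=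
  γ.body.flatMap fun α => gadget (α.mapArgs .elem) (.bodySink α)

/-- The head of the rule that encodes a clause. The object that represents the head atom is linked
to the arguments only by paths of length two, which transitivity turns into edges. In this way the
rules without transitivity do not apply to the result of a rule application. -/
def ruleHead (γ : Clause J k) : List (ℕ × List (RuleVar J k)) :=
  (1, [.headSink]) :: (List.finRange k).flatMap fun i =>
    [(edge γ.head.1 i, [.elem (γ.head.2 i), .headMid]),
      (edge γ.head.1 i, [.headMid, .headSink])] ++
    if γ.head.2 i ∈ γ.bodyVars then [] else [(0, [.elem (γ.head.2 i)])]

/-- The rule that encodes a clause. -/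
def rule (γ : Clause J k) : Rule := codedRule γ.ruleBody γ.ruleHead

theorem forall_mem_ruleBody {D : Type} {r : ℕ → List D → Prop} {u : RuleVar J k → D} :
    (∀ a ∈ γ.ruleBody, r a.1 (a.2.map u)) ↔
      ∀ α ∈ γ.body, Represents r (α.mapArgs (u ∘ .elem)) (u (.bodySink α)) := by
  simp only [ruleBody, List.mem_flatMap, forall_exists_index, and_imp]
  rw [forall_comm]
  refine forall_congr' fun α => ?_
  rw [forall_comm]
  exact forall_congr' fun _ => forall_mem_gadget

theorem exists_mem_ruleBody {y : RuleVar J k} (h : ∃ a ∈ γ.ruleBody, y ∈ a.2) :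
    (∃ x ∈ γ.bodyVars, y = .elem x) ∨ ∃ α, y = .bodySink α := by
  obtain ⟨a, ha, hy⟩ := h
  obtain ⟨α, hα, ha⟩ := List.mem_flatMap.1 ha
  have helem (i : Fin k) : α.2 i ∈ γ.bodyVars := mem_bodyVars.2 ⟨α, hα, i, rfl⟩
  obtain rfl | ⟨i, rfl | rfl⟩ := mem_gadget.1 ha <;>
    simp only [RelAtom.mapArgs, Function.comp_apply, List.mem_cons, List.not_mem_nil,
      or_false] at hy
  · exact .inr ⟨α, hy⟩
  · exact .inl ⟨_, helem i, hy⟩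
  · exact hy.imp (fun hy => ⟨_, helem i, hy⟩) fun hy => ⟨α, hy⟩

theorem exists_elem_mem_ruleBody [NeZero k] {x : ℕ} (hx : x ∈ γ.bodyVars) :
    ∃ a ∈ γ.ruleBody, .elem x ∈ a.2 := by
  obtain ⟨α, hα, i, rfl⟩ := mem_bodyVars.1 hx
  exact ⟨_, List.mem_flatMap.2 ⟨α, hα, mem_gadget.2 (.inr ⟨i, .inl rfl⟩)⟩,
    by simp [RelAtom.mapArgs]⟩

theorem mem_ruleHead {a : ℕ × List (RuleVar J k)} : a ∈ γ.ruleHead ↔ a = (1, [.headSink]) ∨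
    ∃ i, a = (edge γ.head.1 i, [.elem (γ.head.2 i), .headMid]) ∨
      a = (edge γ.head.1 i, [.headMid, .headSink]) ∨
      γ.head.2 i ∉ γ.bodyVars ∧ a = (0, [.elem (γ.head.2 i)]) := by
  simp only [ruleHead, List.mem_cons, List.mem_flatMap, List.mem_append, List.mem_finRange,
    true_and, List.not_mem_nil, or_false, List.mem_ite_nil_left, or_assoc]

end Clause

section ClauseRules

variable {J : Type} {k : ℕ} [Encodable J] {γs : List (Clause J k)}

/-- The rules that encode a list of clauses. -/
def clauseRules (γs : List (Clause J k)) : Finset Rule := (γs.map Clause.rule).toFinset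

variable {C : Type}

/-- The variable for which a null was created. -/
def nullVar (d : ChaseDom C (clauseRules γs)) : Option (RuleVar J k) :=
  d.elim (fun _ => none) fun n => Encodable.decode n.2.1

variable {κ : ℕ → C} {F : Finset Fact} {p : ℕ} {d e : ChaseDom C (clauseRules γs)}
  {l : List (ChaseDom C (clauseRules γs))}

theorem InFacts.nullVar_eq_none (h : InFacts κ F p l) (hd : d ∈ l) : nullVar d = none := by
  obtain ⟨-, -, c, -, rfl⟩ := h.exists_const hd
  rfl

namespace Trigger.Produces

variable {τ : Trigger C (clauseRules γs)}

theorem exists_mem_ruleHead (h : τ.Produces κ p l) :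
    ∃ (γ : Clause J k) (f : RuleVar J k → ChaseDom C (clauseRules γs)),
      (∃ a ∈ γ.ruleHead, a.1 = p ∧ l = a.2.map f) ∧
      ∀ y, (∃ a ∈ γ.ruleHead, y ∈ a.2) → (¬ ∃ a ∈ γ.ruleBody, y ∈ a.2) →
        nullVar (f y) = some y := by
  obtain ⟨b, hb, rfl, rfl⟩ := h
  obtain ⟨γ, -, hγ⟩ := List.mem_map.1 (List.mem_toFinset.1 τ.1.2)
  rw [← hγ] at hb
  obtain ⟨a, ha, rfl⟩ := List.mem_map.1 (List.mem_toFinset.1 hb)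
  refine ⟨γ, fun y => τ.eval κ (var (Encodable.encode y)), ⟨a, ha, rfl, by simp⟩,
    fun y hy hy' => ?_⟩
  have hex : Encodable.encode y ∈ Rule.existVars τ.1.1 := by
    rw [← hγ]
    exact encode_mem_existVars_codedRule.2 ⟨hy, hy'⟩
  change nullVar (τ.assign κ _) = _
  rw [assign_of_mem_existVars hex]
  exact Encodable.encodek y

theorem nullVar_of_zero (h : τ.Produces κ 0 [d]) : ∃ x, nullVar d = some (.elem x) := by
  obtain ⟨γ, f, ⟨a, ha, hp, hl⟩, hf⟩ := h.exists_mem_ruleHead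
  obtain rfl | ⟨i, rfl | rfl | ⟨hi, rfl⟩⟩ := Clause.mem_ruleHead.1 ha
  · cases hp
  · cases hl
  · cases hl
  · cases hl
    refine ⟨_, hf _ ⟨_, ha, by simp⟩ fun hb => ?_⟩
    obtain ⟨x, hx, h⟩ | ⟨α, h⟩ := Clause.exists_mem_ruleBody hb
    · cases h
      exact hi hx
    · cases h

theorem nullVar_of_one (h : τ.Produces κ 1 [d]) : nullVar d = some .headSink := by
  obtain ⟨γ, f, ⟨a, ha, hp, hl⟩, hf⟩ := h.exists_mem_ruleHead
  obtain rfl | ⟨i, rfl | rfl | ⟨-, rfl⟩⟩ := Clause.mem_ruleHead.1 ha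
  · cases hl
    refine hf _ ⟨_, ha, by simp⟩ fun hb => ?_
    obtain ⟨x, -, h⟩ | ⟨α, h⟩ := Clause.exists_mem_ruleBody hb <;> cases h
  · cases hl
  · cases hl
  · cases hp

theorem nullVar_of_pair (h : τ.Produces κ p [d, e]) : nullVar e = some .headMid ∨
    nullVar d = some .headMid ∧ nullVar e = some .headSink := by
  obtain ⟨γ, f, ⟨a, ha, hp, hl⟩, hf⟩ := h.exists_mem_ruleHead
  have hmid : ¬ ∃ a ∈ γ.ruleBody, .headMid ∈ a.2 := fun hb => by
    obtain ⟨x, -, h⟩ | ⟨α, h⟩ := Clause.exists_mem_ruleBody hb <;> cases h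
  have hsink : ¬ ∃ a ∈ γ.ruleBody, .headSink ∈ a.2 := fun hb => by
    obtain ⟨x, -, h⟩ | ⟨α, h⟩ := Clause.exists_mem_ruleBody hb <;> cases h
  obtain rfl | ⟨i, rfl | rfl | ⟨-, rfl⟩⟩ := Clause.mem_ruleHead.1 ha <;> cases hl
  · exact .inl (hf _ ⟨_, ha, by simp⟩ hmid)
  · exact .inr ⟨hf _ ⟨_, ha, by simp⟩ hmid, hf _ ⟨_, ha, by simp⟩ hsink⟩

end Trigger.Produces

theorem inFacts_of_chase (hd : (chase κ F (clauseRules γs)).rel 0 [d])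
    (he : (chase κ F (clauseRules γs)).rel 1 [e])
    (hde : (chase κ F (clauseRules γs)).rel p [d, e]) :
    InFacts κ F 0 [d] ∧ InFacts κ F 1 [e] ∧ InFacts κ F p [d, e] := by
  have hd_ne : nullVar d ≠ some .headMid := by
    obtain hd | ⟨τ, -, hτ⟩ := hd
    · simp [hd.nullVar_eq_none (d := d) (by simp)]
    · obtain ⟨x, hx⟩ := hτ.nullVar_of_zero
      simp [hx]
  have he_ne : nullVar e ≠ some .headMid := by
    obtain he | ⟨τ, -, hτ⟩ := he
    · simp [he.nullVar_eq_none (d := e) (by simp)]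
    · simp [hτ.nullVar_of_one]
  obtain hde | ⟨τ, -, hτ⟩ := hde
  · refine ⟨hd.resolve_right fun ⟨τ, _, hτ⟩ => ?_, he.resolve_right fun ⟨τ, _, hτ⟩ => ?_, hde⟩
    · obtain ⟨x, hx⟩ := hτ.nullVar_of_zero
      cases (hde.nullVar_eq_none (d := d) (by simp)).symm.trans hx
    · cases (hde.nullVar_eq_none (d := e) (by simp)).symm.trans hτ.nullVar_of_one
  · obtain h | ⟨h, -⟩ := hτ.nullVar_of_pair
    exacts [absurd h he_ne, absurd h hd_ne]

theorem Represents.inFacts [NeZero k] {α : RelAtom J k (ChaseDom C (clauseRules γs))}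
    (h : Represents (chase κ F (clauseRules γs)).rel α d) : Represents (InFacts κ F) α d :=
  have hfacts (i : Fin k) := inFacts_of_chase (h.2 i).1 h.1 (h.2 i).2
  ⟨(hfacts 0).2.1, fun i => ⟨(hfacts i).1, (hfacts i).2.2⟩⟩

theorem oneStep_clauseRules [NeZero k] (γs : List (Clause J k)) : OneStep (clauseRules γs) := by
  intro C κ F R hR v hv
  obtain ⟨γ, -, rfl⟩ := List.mem_map.1 (List.mem_toFinset.1 hR)
  have hbody := Clause.forall_mem_ruleBody.1 (forall_mem_codedAtoms.1 hv)
  exact (forall_mem_codedAtoms (M := ⟨Sum.inl ∘ κ, InFacts κ F⟩)).2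
    (Clause.forall_mem_ruleBody.2 fun α hα => (hbody α hα).inFacts)

/-- The transitivity rules for the predicates in the heads of the rules that encode clauses. -/
def transRules (γs : List (Clause J k)) : List Rule :=
  γs.flatMap fun γ => (List.finRange k).map fun i => transRule (edge γ.head.1 i)

/-- The rules that encode a list of clauses together with the transitivity rules. -/
def allRules (γs : List (Clause J k)) : List Rule := γs.map Clause.rule ++ transRules γs

theorem mem_transRules {R : Rule} :
    R ∈ transRules γs ↔ ∃ γ ∈ γs, ∃ i : Fin k, transRule (edge γ.head.1 i) = R := by
  simp [transRules]

theorem allRules_mem_plusTrans [NeZero k] (γs : List (Clause J k)) :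
    (allRules γs).toFinset ∈ plusTrans (fus ∩ fes) := by
  refine ⟨clauseRules γs, ⟨(oneStep_clauseRules γs).mem_fus, (oneStep_clauseRules γs).mem_fes⟩,
    (transRules γs).toFinset, fun R hR => ?_, List.toFinset_append⟩
  obtain ⟨γ, -, i, rfl⟩ := mem_transRules.1 (List.mem_toFinset.1 hR)
  exact isTransitivityRule_transRule _

end ClauseRules

section Reduction

variable {J : Type} {k : ℕ} [Encodable J]

theorem sat_representedAtoms {D : Type} {M : Interp D} {γ : Clause J k} [NeZero k]
    (hγ : M.SatRule γ.rule) (htrans : ∀ i : Fin k, M.SatRule (transRule (edge γ.head.1 i))) :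
    γ.Sat (representedAtoms J k M) := by
  classical
  intro v hv
  choose s hs using hv
  let u : RuleVar J k → D
    | .elem x => v x
    | .bodySink α => if h : α ∈ γ.body then s α h else M.const 0
    | _ => M.const 0
  have hbody : ∀ a ∈ γ.ruleBody, M.rel a.1 (a.2.map u) :=
    Clause.forall_mem_ruleBody.2 fun α hα => by
      have hu : u (.bodySink α) = s α hα := dif_pos hα
      exact hu ▸ hs α hα
  obtain ⟨w, hw, hhead⟩ := satRule_codedRule.1 hγ u hbody
  have hwv (x) (hx : x ∈ γ.bodyVars) : w (.elem x) = v x := by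
    obtain ⟨a, ha, hxa⟩ := Clause.exists_elem_mem_ruleBody hx
    exact hw a ha _ hxa
  refine ⟨w ∘ .elem, hwv, w .headSink, hhead _ (Clause.mem_ruleHead.2 (.inl rfl)),
    fun i => ⟨?_, ?_⟩⟩
  · by_cases hi : γ.head.2 i ∈ γ.bodyVars
    · obtain ⟨α, hα, i', hi'⟩ := Clause.mem_bodyVars.1 hi
      have hmarked : M.rel 0 [v (α.2 i')] := ((hs α hα).2 i').1
      rwa [hi', ← hwv _ hi] at hmarked
    · exact hhead _ (Clause.mem_ruleHead.2 (.inr ⟨i, .inr (.inr ⟨hi, rfl⟩)⟩))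
  · exact satRule_transRule.1 (htrans i) _ _ _
      (hhead _ (Clause.mem_ruleHead.2 (.inr ⟨i, .inl rfl⟩)))
      (hhead _ (Clause.mem_ruleHead.2 (.inr ⟨i, .inr (.inl rfl)⟩)))

/-- The domain of the structure that encodes a set of true atoms over `A`: the elements of `A`, and
an intermediate object and a representing object for each atom. -/
inductive Node (J : Type) (k : ℕ) (A : Type)
  | elem (a : A)
  | mid (α : RelAtom J k A)
  | sink (α : RelAtom J k A)

/-- The relations of the structure that encodes the set `T` of true atoms. -/
inductive NodeRel {A : Type} (T : Set (RelAtom J k A)) : ℕ → List (Node J k A) → Prop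
  | elem (a) : NodeRel T 0 [.elem a]
  | sink (α) : NodeRel T 1 [.sink α]
  | elem_mid {α} (h : α ∈ T) (i : Fin k) : NodeRel T (edge α.1 i) [.elem (α.2 i), .mid α]
  | mid_sink {α} (h : α ∈ T) (i : Fin k) : NodeRel T (edge α.1 i) [.mid α, .sink α]
  | elem_sink {α} (h : α ∈ T) (i : Fin k) : NodeRel T (edge α.1 i) [.elem (α.2 i), .sink α]

/-- The structure that encodes the set `T` of true atoms. -/
def nodeInterp {A : Type} (T : Set (RelAtom J k A)) (ι : ℕ → Node J k A) :
    Interp (Node J k A) where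
  const := ι
  rel := NodeRel T

section NodeInterp

variable {A : Type} {T : Set (RelAtom J k A)}

theorem represents_nodeRel {α : RelAtom J k A} (h : α ∈ T) :
    Represents (NodeRel T) (α.mapArgs .elem) (.sink α) :=
  ⟨.sink α, fun i => ⟨.elem _, .elem_sink h i⟩⟩

namespace NodeRel

variable {p : ℕ} {d e : Node J k A}

theorem single (h : NodeRel T p [d]) : p = 0 ∧ (∃ a, d = .elem a) ∨ p = 1 ∧ ∃ α, d = .sink α := by
  cases h with
  | elem a => exact .inl ⟨rfl, a, rfl⟩
  | sink α => exact .inr ⟨rfl, α, rfl⟩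

theorem pair (h : NodeRel T p [d, e]) : ∃ α ∈ T, ∃ i, p = edge α.1 i ∧
    (d = .elem (α.2 i) ∧ e = .mid α ∨ d = .mid α ∧ e = .sink α ∨
      d = .elem (α.2 i) ∧ e = .sink α) := by
  cases h with
  | elem_mid h i => exact ⟨_, h, i, rfl, .inl ⟨rfl, rfl⟩⟩
  | mid_sink h i => exact ⟨_, h, i, rfl, .inr (.inl ⟨rfl, rfl⟩)⟩
  | elem_sink h i => exact ⟨_, h, i, rfl, .inr (.inr ⟨rfl, rfl⟩)⟩

theorem trans {f : Node J k A} (h : NodeRel T p [d, e]) (h' : NodeRel T p [e, f]) :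
    NodeRel T p [d, f] := by
  obtain ⟨α, hα, i, rfl, ⟨rfl, rfl⟩ | ⟨rfl, rfl⟩ | ⟨rfl, rfl⟩⟩ := h.pair <;>
    obtain ⟨β, -, i', -, ⟨he, rfl⟩ | ⟨he, rfl⟩ | ⟨he, rfl⟩⟩ := h'.pair <;> cases he
  exact .elem_sink hα i

end NodeRel

theorem exists_of_represents_nodeRel [NeZero k] {α : RelAtom J k (Node J k A)} {s : Node J k A}
    (h : Represents (NodeRel T) α s) : ∃ β ∈ T, α = β.mapArgs .elem := by
  obtain ⟨β, rfl⟩ : ∃ β, s = .sink β := by simpa using h.1.single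
  have hcomp (i : Fin k) : β ∈ T ∧ α.1 = β.1 ∧ α.2 i = .elem (β.2 i) := by
    obtain ⟨a, ha⟩ : ∃ a, α.2 i = .elem a := by simpa using (h.2 i).1.single
    obtain ⟨β', hβ', i', hp, ⟨-, he⟩ | ⟨hd, -⟩ | ⟨hd, he⟩⟩ := (h.2 i).2.pair
    · cases he
    · cases ha.symm.trans hd
    · cases he
      obtain ⟨hj, rfl⟩ := edge_inj.1 hp
      exact ⟨hβ', hj, hd⟩
  exact ⟨β, (hcomp 0).1, Prod.ext (hcomp 0).2.1 (funext fun i => (hcomp i).2.2)⟩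

theorem nodeInterp_satRule [NeZero k] [Nonempty A] (ι : ℕ → Node J k A) {γ : Clause J k}
    (h : γ.Sat T) : (nodeInterp T ι).SatRule γ.rule := by
  refine satRule_codedRule.2 fun u hu => ?_
  have hbody (α) (hα : α ∈ γ.body) := exists_of_represents_nodeRel
    (Clause.forall_mem_ruleBody.1 hu α hα)
  have hvar (x) : ∃ a, x ∈ γ.bodyVars → u (.elem x) = .elem a := by
    by_cases hx : x ∈ γ.bodyVars
    · obtain ⟨α, hα, i, rfl⟩ := Clause.mem_bodyVars.1 hx
      obtain ⟨β, -, hαβ⟩ := hbody α hα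
      exact ⟨β.2 i, fun _ => congrFun (congrArg Prod.snd hαβ) i⟩
    · exact ⟨Classical.arbitrary A, fun h => absurd h hx⟩
  choose v hv using hvar
  obtain ⟨w, hw, hhead⟩ := h v fun α hα => by
    obtain ⟨β, hβ, hαβ⟩ := hbody α hα
    have harg (i) : v (α.2 i) = β.2 i := Node.elem.inj <|
      (hv _ (Clause.mem_bodyVars.2 ⟨α, hα, i, rfl⟩)).symm.trans (congrFun (congrArg Prod.snd hαβ) i)
    rwa [RelAtom.mapArgs, show v ∘ α.2 = β.2 from funext harg,
      show α.1 = β.1 from congrArg Prod.fst hαβ]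
  refine ⟨fun
    | .elem x => .elem (w x)
    | .bodySink α => u (.bodySink α)
    | .headMid => .mid (γ.head.mapArgs w)
    | .headSink => .sink (γ.head.mapArgs w), fun a ha y hy => ?_, fun a ha => ?_⟩
  · obtain ⟨x, hx, rfl⟩ | ⟨α, rfl⟩ := Clause.exists_mem_ruleBody ⟨a, ha, hy⟩
    · exact (congrArg _ (hw x hx)).trans (hv x hx).symm
    · rfl
  · obtain rfl | ⟨i, rfl | rfl | ⟨-, rfl⟩⟩ := Clause.mem_ruleHead.1 ha
    · exact .sink _
    · exact .elem_mid hhead i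
    · exact .mid_sink hhead i
    · exact .elem _

end NodeInterp

variable {E : Type} [Encodable E]

/-- The constant for an element of `E`, or for the object that represents an atom over `E`. Tuples
are encoded by `Encodable.finArrow`, the encoding that underlies `Primcodable.finArrow`. -/
def factConst (x : E ⊕ RelAtom J k E) : ℕ :=
  letI : Encodable (Fin k → E) := .finArrow
  Encodable.encode x

theorem factConst_injective : Function.Injective (factConst : E ⊕ RelAtom J k E → ℕ) :=
  letI : Encodable (Fin k → E) := .finArrow
  Encodable.encode_injective

variable (J k) in
/-- The constant for an element of `E`. -/
def eltConst (e : E) : ℕ := factConst (J := J) (k := k) (Sum.inl e)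

/-- The facts that encode an atom over `E`. -/
def RelAtom.facts (φ : RelAtom J k E) : List Fact :=
  (gadget (φ.mapArgs Sum.inl) (Sum.inr φ)).map fun a => (a.1, a.2.map factConst)

/-- The query that asks for an atom with relation symbol `j` and `i`-th argument `e`. -/
def argQuery (j : J) (i : Fin k) (e : E) : Atom :=
  (edge j i, [cst (eltConst J k e), var 0])

theorem forall_satFact_facts {D : Type} {M : Interp D} {φ : RelAtom J k E} :
    (∀ f ∈ φ.facts, M.SatFact f) ↔ Represents M.rel (φ.mapArgs (M.const ∘ eltConst J k))
      (M.const (factConst (Sum.inr φ))) := by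
  simp only [RelAtom.facts, List.forall_mem_map, Interp.SatFact, List.map_map]
  exact forall_mem_gadget

theorem entails_argQuery_of_forall_sat [NeZero k] {γs : List (Clause J k)}
    {φs : List (RelAtom J k E)} {j : J} {i : Fin k} {e : E}
    (h : ∀ (D : Type) (ν : E → D) (T : Set (RelAtom J k D)), (∀ γ ∈ γs, γ.Sat T) →
      (∀ φ ∈ φs, φ.mapArgs ν ∈ T) → ∃ t, t i = ν e ∧ (j, t) ∈ T) :
    Entails (φs.flatMap RelAtom.facts).toFinset (allRules γs).toFinset {argQuery j i e} := by
  rintro D M ⟨hfacts, hrules⟩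
  simp only [List.mem_toFinset, allRules, List.mem_append, or_imp, forall_and] at hfacts hrules
  obtain ⟨t, ht, s, -, hs⟩ := h D (M.const ∘ eltConst J k) (representedAtoms J k M)
    (fun γ hγ => sat_representedAtoms (hrules.1 _ (List.mem_map_of_mem hγ))
      fun i => hrules.2 _ (mem_transRules.2 ⟨γ, hγ, i, rfl⟩))
    fun φ hφ => ⟨_, forall_satFact_facts.1 fun f hf =>
      hfacts f (List.mem_flatMap.2 ⟨φ, hφ, hf⟩)⟩
  refine ⟨fun _ => s, fun a ha => ?_⟩
  rw [Finset.mem_singleton.1 ha]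
  have hedge : M.rel (edge j i) [t i, s] := (hs i).2
  rwa [ht] at hedge

theorem exists_of_entails_argQuery [NeZero k] {γs : List (Clause J k)}
    {φs : List (RelAtom J k E)} {j : J} {i : Fin k} {e : E}
    (h : Entails (φs.flatMap RelAtom.facts).toFinset (allRules γs).toFinset {argQuery j i e})
    {D : Type} (ν : E → D) {T : Set (RelAtom J k D)} (hγs : ∀ γ ∈ γs, γ.Sat T)
    (hφs : ∀ φ ∈ φs, φ.mapArgs ν ∈ T) : ∃ t, t i = ν e ∧ (j, t) ∈ T := by
  have : Nonempty D := ⟨ν e⟩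
  let node : E ⊕ RelAtom J k E → Node J k D := Sum.elim (.elem ∘ ν) fun φ => .sink (φ.mapArgs ν)
  let ι := Function.extend factConst node fun _ => .elem (ν e)
  have hι (x) : ι (factConst x) = node x := factConst_injective.extend_apply _ _ x
  have hιe (e) : ι (eltConst J k e) = .elem (ν e) := hι (Sum.inl e)
  have hmodel : (nodeInterp T ι).IsModel (φs.flatMap RelAtom.facts).toFinset
      (allRules γs).toFinset := by
    refine ⟨fun f hf => ?_, fun R hR => ?_⟩
    · obtain ⟨φ, hφ, hf⟩ := List.mem_flatMap.1 (List.mem_toFinset.1 hf)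
      refine forall_satFact_facts.2 ?_ f hf
      change Represents (NodeRel T) (φ.mapArgs (ι ∘ eltConst J k)) (ι _)
      rw [hι, show ι ∘ eltConst J k = .elem ∘ ν from funext hιe]
      exact represents_nodeRel (hφs φ hφ)
    · obtain hR | hR := List.mem_append.1 (List.mem_toFinset.1 hR)
      · obtain ⟨γ, hγ, rfl⟩ := List.mem_map.1 hR
        exact nodeInterp_satRule ι (hγs γ hγ)
      · obtain ⟨γ, -, i, rfl⟩ := mem_transRules.1 hR
        exact satRule_transRule.2 fun _ _ _ => NodeRel.trans
  obtain ⟨v, hv⟩ := h _ _ hmodel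
  have hrel : NodeRel T (edge j i) [ι (eltConst J k e), v 0] := hv _ (Finset.mem_singleton_self _)
  rw [hιe] at hrel
  obtain ⟨α, hα, i', hp, hd⟩ := hrel.pair
  obtain ⟨rfl, rfl⟩ := edge_inj.1 hp
  refine ⟨α.2, ?_, hα⟩
  obtain ⟨hd, -⟩ | ⟨hd, -⟩ | ⟨hd, -⟩ := hd
  · exact (Node.elem.inj hd).symm
  · cases hd
  · exact (Node.elem.inj hd).symm

end Reduction

/-! ### Clauses for the evaluation of programs -/

section Evaluation

open Turing.ToPartrec

theorem mem_eval_cons {f g : Code} {l u : List ℕ} :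
    u ∈ (f.cons g).eval l ↔ ∃ v ∈ f.eval l, ∃ w ∈ g.eval l, u = v.headI :: w := by
  simp [Part.bind_eq_bind, Part.pure_eq_some]

theorem mem_eval_comp {f g : Code} {l u : List ℕ} :
    u ∈ (f.comp g).eval l ↔ ∃ v ∈ g.eval l, u ∈ f.eval v := by
  rw [Code.comp_eval]
  exact Part.mem_bind_iff

theorem mem_eval_case {f g : Code} {l u : List ℕ} :
    u ∈ (f.case g).eval l ↔ (l.headI = 0 ∧ u ∈ f.eval l.tail) ∨
      ∃ n, l.headI = n + 1 ∧ u ∈ g.eval (n :: l.tail) := by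
  have heval : (f.case g).eval l =
      l.headI.rec (f.eval l.tail) fun n _ => g.eval (n :: l.tail) := by rw [Code.case_eval]
  rw [heval]
  generalize l.headI = m
  cases m <;> simp

theorem mem_eval_fix {f : Code} {l u : List ℕ} :
    u ∈ f.fix.eval l ↔ ∃ v ∈ f.eval l, (v.headI = 0 ∧ u = v.tail) ∨
      (v.headI ≠ 0 ∧ u ∈ f.fix.eval v.tail) := by
  rw [Code.fix_eval]
  constructor
  · intro h
    obtain h | ⟨_, h, hu⟩ := PFun.mem_fix_iff.1 h <;>
      obtain ⟨v, hv, h⟩ := (Part.mem_map_iff _).1 h <;>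
      refine ⟨v, hv, ?_⟩ <;>
      split_ifs at h with h0
    · exact .inl ⟨h0, (Sum.inl.inj h).symm⟩
    · obtain rfl := Sum.inr.inj h
      exact .inr ⟨h0, hu⟩
  · rintro ⟨v, hv, ⟨h0, rfl⟩ | ⟨h0, hu⟩⟩
    · exact PFun.mem_fix_iff.2 (.inl ((Part.mem_map_iff _).2 ⟨v, hv, if_pos h0⟩))
    · exact PFun.mem_fix_iff.2 (.inr ⟨_, (Part.mem_map_iff _).2 ⟨v, hv, if_neg h0⟩, hu⟩)

/-- An injective numbering of programs. -/
def codeNum : Code → ℕ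
  | .zero' => Nat.pair 0 0
  | .succ => Nat.pair 1 0
  | .tail => Nat.pair 2 0
  | .cons f g => Nat.pair 3 (Nat.pair (codeNum f) (codeNum g))
  | .comp f g => Nat.pair 4 (Nat.pair (codeNum f) (codeNum g))
  | .case f g => Nat.pair 5 (Nat.pair (codeNum f) (codeNum g))
  | .fix f => Nat.pair 6 (codeNum f)

theorem codeNum_injective : Function.Injective codeNum := by
  intro c
  induction c with
  | zero' | succ | tail => intro d h; cases d <;> simp [codeNum, Nat.pair_eq_pair] at h ⊢
  | cons f g ihf ihg | comp f g ihf ihg | case f g ihf ihg =>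
    intro d h
    cases d <;> simp only [codeNum, Nat.pair_eq_pair] at h <;> try omega
    rw [ihf h.2.1, ihg h.2.2]
  | fix f ihf =>
    intro d h
    cases d <;> simp only [codeNum, Nat.pair_eq_pair] at h <;> try omega
    rw [ihf h.2]

/-- The ternary relation symbols of the clauses for evaluation. Numbers and lists are built from
one object by one pairing function: the successor of `n` is the pair of the object and `n`. -/
inductive EvalRel
  | pair
  | nil
  | uncons
  | eval (c : Code)

instance : Countable EvalRel := by
  let num : EvalRel → Option (Option (Option ℕ))
    | .pair => none
    | .nil => some none
    | .uncons => some (some none)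
    | .eval c => some (some (some (codeNum c)))
  refine Function.Injective.countable (f := num) fun x y h => ?_
  cases x <;> cases y <;> simp only [num, Option.some.injEq, reduceCtorEq] at h ⊢
  rw [codeNum_injective h]

noncomputable instance : Encodable EvalRel := .ofCountable _

/-- Atoms for the evaluation of programs. -/
abbrev EvalAtom (X : Type) : Type := RelAtom EvalRel 3 X

namespace EvalAtom

variable {X Y : Type}

/-- The object `z` is the pair of `x` and `y`. -/
def pair (x y z : X) : EvalAtom X := (.pair, ![x, y, z])

/-- The object `x` is the number zero and the empty list. -/
def nil (x : X) : EvalAtom X := (.nil, ![x, x, x])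

/-- The list `x` has head `y` and tail `z`, where the head of the empty list is `0`. -/
def uncons (x y z : X) : EvalAtom X := (.uncons, ![x, y, z])

/-- The program `c` computes `y` from `x`. -/
def eval (c : Code) (x y : X) : EvalAtom X := (.eval c, ![x, y, y])

theorem mapArgs_vec (f : X → Y) (j : EvalRel) (x y z : X) :
    RelAtom.mapArgs f (j, ![x, y, z]) = (j, ![f x, f y, f z]) :=
  Prod.ext rfl (funext fun i => by fin_cases i <;> rfl)

@[simp] theorem mapArgs_pair (f : X → Y) (x y z : X) :
    (pair x y z).mapArgs f = pair (f x) (f y) (f z) := mapArgs_vec f ..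

@[simp] theorem mapArgs_nil (f : X → Y) (x : X) : (nil x).mapArgs f = nil (f x) := mapArgs_vec f ..

@[simp] theorem mapArgs_uncons (f : X → Y) (x y z : X) :
    (uncons x y z).mapArgs f = uncons (f x) (f y) (f z) := mapArgs_vec f ..

@[simp] theorem mapArgs_eval (f : X → Y) (c : Code) (x y : X) :
    (eval c x y).mapArgs f = eval c (f x) (f y) := mapArgs_vec f ..

end EvalAtom

open EvalAtom

/-- The clauses for pairing and decomposition. Two objects have a pair if they can be decomposed. -/
def dataClauses : List (Clause EvalRel 3) :=
  [⟨[uncons 0 1 2, uncons 3 4 5], pair 0 3 6⟩,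
    ⟨[nil 0], uncons 0 0 0⟩,
    ⟨[pair 0 1 2], uncons 2 0 1⟩]

/-- The clauses that define the evaluation of `c` by means of that of its immediate subprograms. -/
def stepClauses : Code → List (Clause EvalRel 3)
  | .zero' => [⟨[nil 0, pair 0 1 2], eval .zero' 1 2⟩]
  | .succ => [⟨[nil 0, uncons 1 2 3, pair 0 2 4, pair 4 0 5], eval .succ 1 5⟩]
  | .tail => [⟨[uncons 0 1 2], eval .tail 0 2⟩]
  | .cons f g => [⟨[eval f 0 1, uncons 1 2 3, eval g 0 4, pair 2 4 5], eval (f.cons g) 0 5⟩]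
  | .comp f g => [⟨[eval g 0 1, eval f 1 2], eval (f.comp g) 0 2⟩]
  | .case f g => [⟨[uncons 0 1 2, nil 1, eval f 2 3], eval (f.case g) 0 3⟩,
      ⟨[uncons 0 1 2, pair 3 4 1, pair 4 2 5, eval g 5 6], eval (f.case g) 0 6⟩]
  | .fix f => [⟨[eval f 0 1, uncons 1 2 3, nil 2], eval f.fix 0 3⟩,
      ⟨[eval f 0 1, uncons 1 2 3, pair 4 5 2, eval f.fix 3 6], eval f.fix 0 6⟩]

/-- The clauses that define the evaluation of `c`. -/
def evalClauses (c : Code) : List (Clause EvalRel 3) :=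
  stepClauses c ++ match c with
  | .zero' | .succ | .tail => []
  | .cons f g | .comp f g | .case f g => evalClauses f ++ evalClauses g
  | .fix f => evalClauses f

theorem Clause.sat_iff_of_subset {J A : Type} {k : ℕ} {T : Set (RelAtom J k A)} {γ : Clause J k}
    (hγ : ∀ i, γ.head.2 i ∈ γ.bodyVars) :
    γ.Sat T ↔ ∀ v : ℕ → A, (∀ α ∈ γ.body, α.mapArgs v ∈ T) → γ.head.mapArgs v ∈ T := by
  constructor
  · intro h v hv
    obtain ⟨w, hw, hhead⟩ := h v hv
    rwa [RelAtom.mapArgs, show w ∘ γ.head.2 = v ∘ γ.head.2 from funext fun i => hw _ (hγ i)]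
      at hhead
  · exact fun h v hv => ⟨v, fun _ _ => rfl, h v hv⟩

theorem forall_sat_stepClauses {A : Type} {T : Set (EvalAtom A)} {c : Code} :
    (∀ γ ∈ stepClauses c, γ.Sat T) ↔ ∀ γ ∈ stepClauses c, ∀ v : ℕ → A,
      (∀ α ∈ γ.body, α.mapArgs v ∈ T) → γ.head.mapArgs v ∈ T := by
  refine forall₂_congr fun γ hγ => Clause.sat_iff_of_subset ?_
  revert γ
  cases c <;>
    simp only [stepClauses, List.forall_mem_cons, List.not_mem_nil, false_imp_iff, implies_true,
      and_true] <;>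
    simp [Clause.bodyVars, Fin.forall_fin_succ, pair, nil, uncons, eval]

/-- The intended meaning of the relation symbols. An object is a pair `(n, l)`, which is read as the
number `n` where a number is expected and as the list `l` where a list is expected. -/
def evalModel : Set (EvalAtom (ℕ × List ℕ)) :=
  {α | match α with
    | (.pair, t) => t 2 = ((t 1).1 + 1, (t 0).1 :: (t 1).2)
    | (.nil, t) => t 0 = (0, [])
    | (.uncons, t) => (t 1).1 = (t 0).2.headI ∧ (t 2).2 = (t 0).2.tail
    | (.eval c, t) => (t 1).2 ∈ c.eval (t 0).2}

section EvalModel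

variable {x y z : ℕ × List ℕ}

theorem pair_mem_evalModel : pair x y z ∈ evalModel ↔ z = (y.1 + 1, x.1 :: y.2) := Iff.rfl

theorem nil_mem_evalModel : nil x ∈ evalModel ↔ x = (0, []) := Iff.rfl

theorem uncons_mem_evalModel :
    uncons x y z ∈ evalModel ↔ y.1 = x.2.headI ∧ z.2 = x.2.tail := Iff.rfl

theorem eval_mem_evalModel {c : Code} : eval c x y ∈ evalModel ↔ y.2 ∈ c.eval x.2 := Iff.rfl

end EvalModel

theorem sat_evalModel_dataClauses : ∀ γ ∈ dataClauses, γ.Sat evalModel := by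
  simp only [dataClauses, List.forall_mem_cons, List.not_mem_nil, false_imp_iff, implies_true,
    and_true]
  refine ⟨fun v _ => ⟨Function.update v 6 ((v 3).1 + 1, (v 0).1 :: (v 3).2), ?_, ?_⟩,
    (Clause.sat_iff_of_subset ?_).2 fun v hv => ?_, (Clause.sat_iff_of_subset ?_).2 fun v hv => ?_⟩
  · simp [Clause.bodyVars, uncons]
  · simp [pair_mem_evalModel]
  · simp [Clause.bodyVars, nil, uncons, Fin.forall_fin_succ]
  · simp_all [nil_mem_evalModel, uncons_mem_evalModel]
  · simp [Clause.bodyVars, pair, uncons, Fin.forall_fin_succ]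
  · simp_all [pair_mem_evalModel, uncons_mem_evalModel]

theorem sat_evalModel_stepClauses {c : Code} : ∀ γ ∈ stepClauses c, γ.Sat evalModel := by
  rw [forall_sat_stepClauses]
  cases c <;>
    simp only [stepClauses, List.forall_mem_cons, List.not_mem_nil, false_imp_iff, implies_true,
      and_true, mapArgs_pair, mapArgs_nil, mapArgs_uncons, mapArgs_eval, nil_mem_evalModel,
      pair_mem_evalModel, uncons_mem_evalModel, eval_mem_evalModel, mem_eval_cons, mem_eval_comp,
      mem_eval_case, and_imp]
  case zero' | succ | tail => simp +contextual
  case cons =>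
    intro v hf hhead _ hg hpair
    exact ⟨_, hf, _, hg, by rw [hpair, hhead]⟩
  case comp => exact fun v hg hf => ⟨_, hg, hf⟩
  case case =>
    refine ⟨fun v hhead htail hnil hf => .inl ⟨?_, htail ▸ hf⟩,
      fun v hhead htail hpred hpair hg => .inr ⟨(v 4).1, ?_, ?_⟩⟩
    · rw [← hhead, hnil]
    · rw [← hhead, hpred]
    · rwa [hpair, htail] at hg
  case fix =>
    refine ⟨fun v hf hhead htail hnil => mem_eval_fix.2 ⟨_, hf, .inl ⟨?_, htail⟩⟩,
      fun v hf hhead htail hpred hfix => mem_eval_fix.2 ⟨_, hf, .inr ⟨?_, htail ▸ hfix⟩⟩⟩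
    · rw [← hhead, hnil]
    · rw [← hhead, hpred]
      exact Nat.succ_ne_zero _

theorem sat_evalModel_evalClauses (c : Code) : ∀ γ ∈ evalClauses c, γ.Sat evalModel := by
  induction c with
  | zero' | succ | tail => exact List.forall_mem_append.2 ⟨sat_evalModel_stepClauses, nofun⟩
  | cons f g ihf ihg | comp f g ihf ihg | case f g ihf ihg =>
    exact List.forall_mem_append.2
      ⟨sat_evalModel_stepClauses, List.forall_mem_append.2 ⟨ihf, ihg⟩⟩
  | fix f ihf => exact List.forall_mem_append.2 ⟨sat_evalModel_stepClauses, ihf⟩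

end Evaluation

section Representation

open Turing.ToPartrec EvalAtom

variable {D : Type}

/-- The object `d` represents the number `n` in the structure `T`. -/
def NatRep (T : Set (EvalAtom D)) : ℕ → D → Prop
  | 0, d => nil d ∈ T
  | n + 1, d => ∃ o a, nil o ∈ T ∧ NatRep T n a ∧ pair o a d ∈ T

/-- The object `d` represents the list `l` in the structure `T`. -/
def ListRep (T : Set (EvalAtom D)) : List ℕ → D → Prop
  | [], d => nil d ∈ T
  | n :: l, d => ∃ a b, NatRep T n a ∧ ListRep T l b ∧ pair a b d ∈ T

/-- In the structure `T`, the program `c` computes a representation of its output from each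
representation of an input on which it halts. -/
def Computes (T : Set (EvalAtom D)) (c : Code) : Prop :=
  ∀ l, ∀ u ∈ c.eval l, ∀ d, ListRep T l d → ∃ e, ListRep T u e ∧ eval c d e ∈ T

section DataClauses

variable {T : Set (EvalAtom D)} (hdata : ∀ γ ∈ dataClauses, γ.Sat T)

include hdata

theorem uncons_mem_of_nil {x : D} (h : nil x ∈ T) : uncons x x x ∈ T := by
  have hsat := hdata ⟨[nil 0], uncons 0 0 0⟩ (by simp [dataClauses])
  rw [Clause.sat_iff_of_subset (by simp [Clause.bodyVars, nil, uncons, Fin.forall_fin_succ])]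
    at hsat
  simpa using hsat (fun _ => x) (by simpa using h)

theorem uncons_mem_of_pair {x y z : D} (h : pair x y z ∈ T) : uncons z x y ∈ T := by
  have hsat := hdata ⟨[pair 0 1 2], uncons 2 0 1⟩ (by simp [dataClauses])
  rw [Clause.sat_iff_of_subset (by simp [Clause.bodyVars, pair, uncons, Fin.forall_fin_succ])]
    at hsat
  simpa using hsat (fun n => [x, y].getD n z) (by simpa using h)

theorem exists_uncons_mem_of_natRep {n : ℕ} {d : D} (h : NatRep T n d) :
    ∃ x y, uncons d x y ∈ T := by
  cases n with
  | zero => exact ⟨d, d, uncons_mem_of_nil hdata h⟩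
  | succ n =>
    obtain ⟨o, a, -, -, hpair⟩ := h
    exact ⟨o, a, uncons_mem_of_pair hdata hpair⟩

theorem exists_uncons_mem_of_listRep {l : List ℕ} {d : D} (h : ListRep T l d) :
    ∃ a b, NatRep T l.headI a ∧ ListRep T l.tail b ∧ uncons d a b ∈ T := by
  cases l with
  | nil => exact ⟨d, d, h, h, uncons_mem_of_nil hdata h⟩
  | cons n l =>
    obtain ⟨a, b, ha, hb, hpair⟩ := h
    exact ⟨a, b, ha, hb, uncons_mem_of_pair hdata hpair⟩

theorem exists_pair_mem {x y : D} (hx : ∃ a b, uncons x a b ∈ T) (hy : ∃ a b, uncons y a b ∈ T) :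
    ∃ z, pair x y z ∈ T := by
  obtain ⟨a, b, hx⟩ := hx
  obtain ⟨a', b', hy⟩ := hy
  obtain ⟨w, hw, hpair⟩ := hdata ⟨[uncons 0 1 2, uncons 3 4 5], pair 0 3 6⟩ (by simp [dataClauses])
    (fun n => [x, a, b, y, a', b'].getD n x) (by simpa using ⟨hx, hy⟩)
  have hw0 := hw 0 (by simp [Clause.bodyVars, uncons])
  have hw3 := hw 3 (by simp [Clause.bodyVars, uncons])
  exact ⟨w 6, by simpa [hw0, hw3] using hpair⟩

theorem exists_natRep_succ {n : ℕ} {o a : D} (ho : nil o ∈ T) (ha : NatRep T n a) :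
    ∃ d, NatRep T (n + 1) d ∧ pair o a d ∈ T := by
  obtain ⟨d, hd⟩ := exists_pair_mem hdata ⟨_, _, uncons_mem_of_nil hdata ho⟩
    (exists_uncons_mem_of_natRep hdata ha)
  exact ⟨d, ⟨o, a, ho, ha, hd⟩, hd⟩

theorem exists_listRep_cons {n : ℕ} {l : List ℕ} {a b : D} (ha : NatRep T n a)
    (hb : ListRep T l b) : ∃ d, ListRep T (n :: l) d ∧ pair a b d ∈ T := by
  obtain ⟨x, y, -, -, hxy⟩ := exists_uncons_mem_of_listRep hdata hb
  obtain ⟨d, hd⟩ := exists_pair_mem hdata (exists_uncons_mem_of_natRep hdata ha) ⟨x, y, hxy⟩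
  exact ⟨d, ⟨a, b, ha, hb, hd⟩, hd⟩

end DataClauses

namespace Computes

variable {T : Set (EvalAtom D)} {f g : Code}

section Pairing

variable (hdata : ∀ γ ∈ dataClauses, γ.Sat T)

include hdata

theorem zero' {o : D} (ho : nil o ∈ T) (hstep : ∀ γ ∈ stepClauses .zero', γ.Sat T) :
    Computes T .zero' := by
  intro l u hu d hd
  rw [Code.zero'_eval] at hu
  obtain rfl := Part.mem_some_iff.1 hu
  obtain ⟨e, he, hpair⟩ := exists_listRep_cons hdata (n := 0) ho hd
  refine ⟨e, he, ?_⟩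
  simpa using forall_sat_stepClauses.1 hstep _ (.head _)
    (fun n => [o, d].getD n e) (by simpa using ⟨ho, hpair⟩)

theorem succ {o : D} (ho : nil o ∈ T) (hstep : ∀ γ ∈ stepClauses .succ, γ.Sat T) :
    Computes T .succ := by
  intro l u hu d hd
  rw [Code.succ_eval] at hu
  obtain rfl := Part.mem_some_iff.1 hu
  obtain ⟨a, b, ha, -, huncons⟩ := exists_uncons_mem_of_listRep hdata hd
  obtain ⟨a', ha', hsucc⟩ := exists_natRep_succ hdata ho ha
  obtain ⟨e, he, hpair⟩ := exists_listRep_cons hdata (l := []) ha' ho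
  refine ⟨e, he, ?_⟩
  simpa using forall_sat_stepClauses.1 hstep _ (.head _)
    (fun n => [o, d, a, b, a'].getD n e) (by simpa using ⟨ho, huncons, hsucc, hpair⟩)

theorem tail (hstep : ∀ γ ∈ stepClauses .tail, γ.Sat T) : Computes T .tail := by
  intro l u hu d hd
  rw [Code.tail_eval] at hu
  obtain rfl := Part.mem_some_iff.1 hu
  obtain ⟨a, e, -, he, huncons⟩ := exists_uncons_mem_of_listRep hdata hd
  refine ⟨e, he, ?_⟩
  simpa using forall_sat_stepClauses.1 hstep _ (.head _)
    (fun n => [d, a].getD n e) (by simpa using huncons)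

theorem cons (hstep : ∀ γ ∈ stepClauses (f.cons g), γ.Sat T) (hf : Computes T f)
    (hg : Computes T g) : Computes T (f.cons g) := by
  intro l u hu d hd
  obtain ⟨v, hv, w, hw, rfl⟩ := mem_eval_cons.1 hu
  obtain ⟨x, hx, hfx⟩ := hf l v hv d hd
  obtain ⟨y, hy, hgy⟩ := hg l w hw d hd
  obtain ⟨a, b, ha, -, huncons⟩ := exists_uncons_mem_of_listRep hdata hx
  obtain ⟨e, he, hpair⟩ := exists_listRep_cons hdata ha hy
  refine ⟨e, he, ?_⟩
  simpa using forall_sat_stepClauses.1 hstep _ (.head _)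
    (fun n => [d, x, a, b, y].getD n e) (by simpa using ⟨hfx, huncons, hgy, hpair⟩)

theorem case (hstep : ∀ γ ∈ stepClauses (f.case g), γ.Sat T) (hf : Computes T f)
    (hg : Computes T g) : Computes T (f.case g) := by
  intro l u hu d hd
  obtain ⟨a, b, ha, hb, huncons⟩ := exists_uncons_mem_of_listRep hdata hd
  obtain ⟨hl, hu⟩ | ⟨n, hl, hu⟩ := mem_eval_case.1 hu <;> rw [hl] at ha
  · obtain ⟨e, he, hfe⟩ := hf _ u hu b hb
    refine ⟨e, he, ?_⟩
    simpa using forall_sat_stepClauses.1 hstep _ (.head _)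
      (fun n => [d, a, b].getD n e) (by simpa using ⟨huncons, ha, hfe⟩)
  · obtain ⟨o, a', -, ha', hsucc⟩ := ha
    obtain ⟨x, hx, hpair⟩ := exists_listRep_cons hdata ha' hb
    obtain ⟨e, he, hge⟩ := hg _ u hu x hx
    refine ⟨e, he, ?_⟩
    simpa using forall_sat_stepClauses.1 hstep _ (.tail _ (.head _))
      (fun n => [d, a, b, o, a', x].getD n e) (by simpa using ⟨huncons, hsucc, hpair, hge⟩)

theorem fix (hstep : ∀ γ ∈ stepClauses f.fix, γ.Sat T) (hf : Computes T f) :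
    Computes T f.fix := by
  intro l u hu
  rw [Code.fix_eval] at hu
  refine PFun.fixInduction' (C := fun l => ∀ d, ListRep T l d →
    ∃ e, ListRep T u e ∧ eval f.fix d e ∈ T) hu (fun l hl d hd => ?_) (fun l l' _ hl ih d hd => ?_)
  all_goals
    obtain ⟨v, hv, h⟩ := (Part.mem_map_iff _).1 hl
    obtain ⟨x, hx, hfx⟩ := hf l v hv d hd
    obtain ⟨a, b, ha, hb, huncons⟩ := exists_uncons_mem_of_listRep hdata hx
    split_ifs at h with hhead
  · obtain rfl := Sum.inl.inj h
    rw [hhead] at ha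
    refine ⟨b, hb, ?_⟩
    simpa using forall_sat_stepClauses.1 hstep _ (.head _)
      (fun n => [d, x, a].getD n b) (by simpa using ⟨hfx, huncons, ha⟩)
  · obtain rfl := Sum.inr.inj h
    obtain ⟨n, hn⟩ := Nat.exists_eq_succ_of_ne_zero hhead
    rw [hn] at ha
    obtain ⟨o, a', -, -, hsucc⟩ := ha
    obtain ⟨e, he, hfix⟩ := ih b hb
    refine ⟨e, he, ?_⟩
    simpa using forall_sat_stepClauses.1 hstep _ (.tail _ (.head _))
      (fun n => [d, x, a, b, o, a'].getD n e) (by simpa using ⟨hfx, huncons, hsucc, hfix⟩)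

end Pairing

theorem comp (hstep : ∀ γ ∈ stepClauses (f.comp g), γ.Sat T)
    (hf : Computes T f) (hg : Computes T g) : Computes T (f.comp g) := by
  intro l u hu d hd
  obtain ⟨v, hv, hu⟩ := mem_eval_comp.1 hu
  obtain ⟨x, hx, hgx⟩ := hg l v hv d hd
  obtain ⟨e, he, hfe⟩ := hf v u hu x hx
  refine ⟨e, he, ?_⟩
  simpa using forall_sat_stepClauses.1 hstep _ (.head _)
    (fun n => [d, x].getD n e) (by simpa using ⟨hgx, hfe⟩)

end Computes

theorem computes_of_sat_evalClauses {T : Set (EvalAtom D)} (hdata : ∀ γ ∈ dataClauses, γ.Sat T)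
    {o : D} (ho : nil o ∈ T) {c : Code} (h : ∀ γ ∈ evalClauses c, γ.Sat T) : Computes T c := by
  induction c with
  | zero' => exact .zero' hdata ho (List.forall_mem_append.1 h).1
  | succ => exact .succ hdata ho (List.forall_mem_append.1 h).1
  | tail => exact .tail hdata (List.forall_mem_append.1 h).1
  | cons f g ihf ihg =>
    obtain ⟨hstep, hsub⟩ := List.forall_mem_append.1 h
    obtain ⟨hf, hg⟩ := List.forall_mem_append.1 hsub
    exact .cons hdata hstep (ihf hf) (ihg hg)
  | comp f g ihf ihg =>
    obtain ⟨hstep, hsub⟩ := List.forall_mem_append.1 h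
    obtain ⟨hf, hg⟩ := List.forall_mem_append.1 hsub
    exact .comp hstep (ihf hf) (ihg hg)
  | case f g ihf ihg =>
    obtain ⟨hstep, hsub⟩ := List.forall_mem_append.1 h
    obtain ⟨hf, hg⟩ := List.forall_mem_append.1 hsub
    exact .case hdata hstep (ihf hf) (ihg hg)
  | fix f ihf =>
    obtain ⟨hstep, hsub⟩ := List.forall_mem_append.1 h
    exact .fix hdata hstep (ihf hsub)

end Representation

section Undecidability

open Turing.ToPartrec EvalAtom

/-- The atoms that describe the list `[n]`, which is the element `none`, by means of the numbers up
to `n`, where `some m` is the number `m`. -/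
def inputAtoms (n : ℕ) : List (EvalAtom (Option ℕ)) :=
  [nil (some 0), pair (some n) (some 0) none] ++
    (List.range n).map fun m => pair (some 0) (some m) (some (m + 1))

/-- The facts that describe the list `[n]`. -/
noncomputable def inputFacts (n : ℕ) : List Fact := (inputAtoms n).flatMap RelAtom.facts

theorem forall_mem_inputAtoms {n : ℕ} {p : EvalAtom (Option ℕ) → Prop} :
    (∀ φ ∈ inputAtoms n, p φ) ↔ p (nil (some 0)) ∧ p (pair (some n) (some 0) none) ∧
      ∀ m < n, p (pair (some 0) (some m) (some (m + 1))) := by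
  simp [inputAtoms, or_imp, forall_and]

theorem listRep_of_mapArgs_inputAtoms_mem {D : Type} {T : Set (EvalAtom D)} {ν : Option ℕ → D}
    {n : ℕ} (h : ∀ φ ∈ inputAtoms n, φ.mapArgs ν ∈ T) : ListRep T [n] (ν none) := by
  simp only [forall_mem_inputAtoms, mapArgs_nil, mapArgs_pair] at h
  obtain ⟨hnil, hpair, hsucc⟩ := h
  have hnat (m : ℕ) (hm : m ≤ n) : NatRep T m (ν (some m)) := by
    induction m with
    | zero => exact hnil
    | succ m ih => exact ⟨_, _, hnil, ih (by lia), hsucc m hm⟩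
  exact ⟨_, _, hnat n le_rfl, hnil, hpair⟩

/-- The rules for the evaluation of `c`. -/
noncomputable def evalRules (c : Code) : List Rule := allRules (dataClauses ++ evalClauses c)

/-- The query that asks for an output of `c` on the input described by the facts. -/
noncomputable def haltQuery (c : Code) : Atom :=
  argQuery (EvalRel.eval c) (0 : Fin 3) (none : Option ℕ)

theorem entails_haltQuery_iff {c : Code} {n : ℕ} :
    Entails (inputFacts n).toFinset (evalRules c).toFinset {haltQuery c} ↔
      (c.eval [n]).Dom := by
  constructor
  · intro h
    let ν : Option ℕ → ℕ × List ℕ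
      | some m => (m, List.replicate m 0)
      | none => (1, [n])
    obtain ⟨t, ht, hmem⟩ := exists_of_entails_argQuery h ν
      (List.forall_mem_append.2 ⟨sat_evalModel_dataClauses, sat_evalModel_evalClauses c⟩)
      (forall_mem_inputAtoms.2 (by
        simp [nil_mem_evalModel, pair_mem_evalModel, ν, List.replicate_succ]))
    have heval : (t 1).2 ∈ c.eval (t 0).2 := hmem
    rw [ht] at heval
    exact Part.dom_iff_mem.2 ⟨_, heval⟩
  · intro h
    obtain ⟨u, hu⟩ := Part.dom_iff_mem.1 h
    refine entails_argQuery_of_forall_sat fun D ν T hγs hφs => ?_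
    obtain ⟨hdata, heval⟩ := List.forall_mem_append.1 hγs
    have hnil : nil (ν (some 0)) ∈ T := mapArgs_nil ν _ ▸ (forall_mem_inputAtoms.1 hφs).1
    obtain ⟨e, -, he⟩ := computes_of_sat_evalClauses hdata hnil heval _ u hu _
      (listRep_of_mapArgs_inputAtoms_mem hφs)
    exact ⟨_, rfl, he⟩

theorem primrec_facts {J E : Type} [Encodable J] [Primcodable E] {k : ℕ} (j : J) :
    Primrec fun t : Fin k → E => RelAtom.facts (j, t) := by
  have hsink : Primrec fun t : Fin k → E => factConst (Sum.inr (j, t)) :=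
    Primrec.nat_double_succ.comp
      (Primrec₂.natPair.comp (.const (Encodable.encode j)) Primrec.encode)
  have harg : Primrec₂ fun (t : Fin k → E) i => eltConst J k (t i) :=
    Primrec.nat_double.comp (Primrec.encode.comp Primrec.fin_app)
  have hedge : Primrec₂ fun (_ : Fin k → E) (i : Fin k) => edge j i :=
    (Primrec.dom_finite _).comp .snd
  have single (p : ℕ) {α : Type} [Primcodable α] {f : α → ℕ} (hf : Primrec f) :
      Primrec fun a => ((p, [f a]) : Fact) :=
    (Primrec.const p).pair (Primrec.list_cons.comp hf (.const []))
  have hpair : Primrec₂ fun (t : Fin k → E) i =>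
      [((0, [eltConst J k (t i)]) : Fact),
        (edge j i, [eltConst J k (t i), factConst (Sum.inr (j, t))])] :=
    Primrec.list_cons.comp (single 0 harg) (Primrec.list_cons.comp
      (Primrec.pair hedge (Primrec.list_cons.comp harg
        (Primrec.list_cons.comp (hsink.comp .fst) (.const [])))) (.const []))
  refine (Primrec.list_cons.comp (single 1 hsink)
    (Primrec.list_flatMap (.const (List.finRange k)) hpair)).of_eq fun t => ?_
  simp [RelAtom.facts, gadget, List.map_flatMap, RelAtom.mapArgs, eltConst]

theorem primrec_vec {α E : Type} [Primcodable α] [Primcodable E] {f g h : α → E}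
    (hf : Primrec f) (hg : Primrec g) (hh : Primrec h) : Primrec fun a => ![f a, g a, h a] :=
  Primrec.fin_curry.2 (Primrec₂.swap (Primrec.fin_curry₁.2 fun i => by
    fin_cases i
    exacts [hf, hg, hh]))

theorem primrec_inputFacts : Primrec inputFacts := by
  have hpair {α : Type} [Primcodable α] {f g h : α → Option ℕ} (hf : Primrec f) (hg : Primrec g)
      (hh : Primrec h) : Primrec fun a => (pair (f a) (g a) (h a)).facts :=
    (primrec_facts EvalRel.pair).comp (primrec_vec hf hg hh)
  have hsucc : Primrec₂ fun (_ : ℕ) m => (pair (some 0) (some m) (some (m + 1))).facts :=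
    hpair (.const _) (Primrec.option_some.comp .snd)
      (Primrec.option_some.comp (Primrec.succ.comp .snd))
  have hlist : Primrec fun n => (pair (some n) (some 0) none).facts :=
    hpair Primrec.option_some (.const _) (.const _)
  refine (Primrec.list_append.comp (.const (nil (some 0)).facts) (Primrec.list_append.comp hlist
    (Primrec.list_flatMap Primrec.list_range hsucc))).of_eq fun n => ?_
  simp [inputFacts, inputAtoms, List.flatMap_map]

theorem exists_code_not_computablePred :
    ∃ c : Code, ¬ ComputablePred fun n : ℕ => (c.eval [n]).Dom := by
  have hp : Partrec fun n : ℕ => Nat.Partrec.Code.eval (Denumerable.ofNat Nat.Partrec.Code n) 0 :=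
    Nat.Partrec.Code.eval_part.comp (Computable.ofNat _) (Computable.const 0)
  obtain ⟨c, hc⟩ := Code.exists_code (Nat.Partrec'.part_iff₁.2 hp)
  refine ⟨c, fun h => ComputablePred.halting_problem 0
    (ComputablePred.computable_of_manyOneReducible ⟨Encodable.encode, Computable.encode, ?_⟩ h)⟩
  intro d
  have heval := hc (Encodable.encode d ::ᵥ List.Vector.nil)
  change c.eval [Encodable.encode d] = _ at heval
  simp [heval]

theorem AtomicEntailmentDecidable.computablePred {𝓒 : Set (Finset Rule)}
    (h : AtomicEntailmentDecidable 𝓒) {𝓡 : List Rule} (h𝓡 : 𝓡.toFinset ∈ 𝓒) (q : Atom) :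
    ComputablePred fun F : List Fact => Entails F.toFinset 𝓡.toFinset {q} := by
  obtain ⟨f, hf, hdec⟩ := h
  choose b hb hbE using fun F : List Fact => hdec (F, 𝓡) q h𝓡
  refine ComputablePred.computable_iff.2 ⟨b, ?_, funext fun F => propext (hbE F).symm⟩
  exact (hf.comp ((Computable.id.pair (.const 𝓡)).pair (.const q))).of_eq_tot hb

theorem plusTrans_mono {𝓒 𝓓 : Set (Finset Rule)} (h : 𝓒 ⊆ 𝓓) : plusTrans 𝓒 ⊆ plusTrans 𝓓 :=
  fun _ ⟨𝓡, h𝓡, h𝓢⟩ => ⟨𝓡, h h𝓡, h𝓢⟩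

end Undecidability

end ExRule

theorem mainTheorem8_general : ∃ (𝓡 : List ExRule.Rule) (q : ExRule.Atom),
    𝓡.toFinset ∈ ExRule.plusTrans (ExRule.fus ∩ ExRule.fes) ∧
      ¬ ComputablePred fun F : List ExRule.Fact => ExRule.Entails F.toFinset 𝓡.toFinset {q} := by
  obtain ⟨c, hc⟩ := ExRule.exists_code_not_computablePred
  refine ⟨ExRule.evalRules c, ExRule.haltQuery c, ExRule.allRules_mem_plusTrans _, fun h => hc ?_⟩
  exact ComputablePred.computable_of_manyOneReducible
    ⟨ExRule.inputFacts, ExRule.primrec_inputFacts.to_comp,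
      fun _ => ExRule.entails_haltQuery_iff.symm⟩ h

theorem mainTheorem8 :
    ¬ ExRule.AtomicEntailmentDecidable (ExRule.plusTrans ExRule.fus) ∧
      ¬ ExRule.AtomicEntailmentDecidable (ExRule.plusTrans ExRule.fes) := by
  obtain ⟨𝓡, q, h𝓡, hq⟩ := mainTheorem8_general
  exact ⟨fun h => hq (h.computablePred (ExRule.plusTrans_mono Set.inter_subset_left h𝓡) q),
    fun h => hq (h.computablePred (ExRule.plusTrans_mono Set.inter_subset_right h𝓡) q)⟩
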